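/- Let $N\ge 1$ be an integer, $\chi$ a Dirichlet character modulo $N$ and $k$ an integer. For $M\ge 1$ divisible by $N$ let $S_k(\Gamma_0(M),\chi)$ be the space of cusp forms of weight $k$ and character $\chi$ (viewed modulo $M$) for $\Gamma_0(M)$, with the normalized Petersson product $$\langle f,g\rangle=\frac1{(\mathrm{SL}_2(\mathbb Z):\Gamma_0(M))}\int_{\mathcal F}f(x+iy)\overline{g(x+iy)}\,y^{k-2}\,dx\,dy,$$ where $\mathcal F$ is a fundamental domain for $\Gamma_0(M)$; it does not depend on the choice of the level $M$. Put $(f|V_\ell)(z)=f(\ell z)$. Let $f\in S_k(\Gamma_0(N),\chi)$ be a primitive form, that is, $f$ is orthogonal to all oldforms of level $N$, is an eigenfunction of all Hecke operators $T_N(\ell,m)$ with $\ell\mid m$ and $\gcd(\ell,N)=1$, and has first Fourier coefficient $1$. Here $T_N(\ell,m)$ is given by the double coset $\Gamma_0(N)\left(\begin{smallmatrix}\ell&0\\0&m\end{smallmatrix}\right)\Gamma_0(N)=\bigsqcup_\alpha\Gamma_0(N)\alpha$ through $$(f|T_N(\ell,m))(z)=\sum_{\alpha=\left(\begin{smallmatrix}a&b\\c&d\end{smallmatrix}\right)}\chi(a)\,(\ell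 m)^{k-1}(cz+d)^{-k}f\!\left(\tfrac{az+b}{cz+d}\right).$$ Put $\tilde f=f/\sqrt{\langle f,f\rangle}$, let $p$ be a prime, $r\ge 0$ an integer, and let $\lambda(1,p)$ be the eigenvalue of $f$ under $T_N(1,p)$. Let $W_p(f)$ be the span of $f, f|V_p,\dots,f|V_{p^r}$, and let $M\ge 1$ be any multiple of $Np^r$. Then $W_p(f)\subseteq S_k(\Gamma_0(M),\chi)$, the integrals defining the Petersson products of elements of $W_p(f)$ converge, and the following holds. (a) If $p\mid N$, then $W_p(f)$ has an orthogonal basis $g_0,\dots,g_r$ given by $$g_0=\tilde f,\qquad g_j=p^{jk/2}\Bigl(\tilde f|V_{p^j}-\frac{\overline{\lambda(1,p)}}{p^k}\,\tilde f|V_{p^{j-1}}\Bigr)\quad(1\le j\le r),$$ with $\langle g_0,g_0\rangle=1$ and $\langle g_j,g_j\rangle=1-\dfrac{|\lambda(1,p)|^2}{p^k}$ for $1\le j\le r$. (b) If $p\nmid N$, then $W_p(f)$ has an orthogonal basis $g_0,\dots,g_r$ given by $$g_0=\tilde f,\qquad g_1=p^{k/2}\,\tilde f|V_p-\frac{\overline{\lambda(1,p)}}{p^{k/2}(1+\frac1p)}\,\tilde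 f,$$ $$g_j=p^{jk/2}\Bigl(\tilde f|V_{p^j}-\frac{\overline{\lambda(1,p)}}{p^k}\,\tilde f|V_{p^{j-1}}+\frac{\overline{\chi(p)}}{p^{k+1}}\,\tilde f|V_{p^{j-2}}\Bigr)\quad(2\le j\le r),$$ with $\langle g_0,g_0\rangle=1$, $$\langle g_1,g_1\rangle=1-\frac{|\lambda(1,p)|^2}{p^k(1+\frac1p)^2}\quad(\text{if } r\ge 1),$$ $$\langle g_j,g_j\rangle=\Bigl(1-\frac1{p^2}\Bigr)\Bigl(1-\frac{|\lambda(1,p)|^2}{p^k(1+\frac1p)^2}\Bigr)\quad(2\le j\le r).$$ -/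

import Mathlib

open UpperHalfPlane ModularForm CongruenceSubgroup Modular MeasureTheory
open scoped MatrixGroups ModularForm

noncomputable section

namespace PrimitiveTranslates

/-- `S_k(Γ₀(N), χ)`: the cusp forms `f` of weight `k` for `Γ₁(N)` with
`f ∣[k] γ = χ(d) f` for all `γ = (a, b; c, d) ∈ Γ₀(N)`, as a space of functions on `ℍ`. -/
def cuspFormSpace (N : ℕ) (χ : DirichletCharacter ℂ N) (k : ℤ) : Submodule ℂ (ℍ → ℂ) where
  carrier := {f | (∃ F : CuspForm ((Gamma1 N).map (Matrix.SpecialLinearGroup.mapGL ℝ)) k,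
      (F : ℍ → ℂ) = f) ∧
    ∀ γ ∈ Gamma0 N, f ∣[k] γ = χ ((γ 1 1 : ℤ) : ZMod N) • f}
  zero_mem' := by
    refine ⟨⟨0, rfl⟩, fun γ _ => ?_⟩
    rw [SlashAction.zero_slash, smul_zero]
  add_mem' := by
    rintro f g ⟨⟨F, rfl⟩, hF⟩ ⟨⟨G, rfl⟩, hG⟩
    refine ⟨⟨F + G, rfl⟩, fun γ hγ => ?_⟩
    rw [SlashAction.add_slash, hF γ hγ, hG γ hγ, smul_add]
  smul_mem' := by
    rintro c f ⟨⟨F, rfl⟩, hF⟩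
    refine ⟨⟨c • F, rfl⟩, fun γ hγ => ?_⟩
    rw [ModularForm.SL_smul_slash, hF γ hγ, smul_comm]

/-- The standard fundamental domain for `Γ₀(M)`: the union of the translates `g⁻¹ 𝒟` of the
standard fundamental domain `𝒟` of `SL₂(ℤ)`, where `g` runs over representatives of
`SL₂(ℤ) / Γ₀(M)`. -/
def fundDomain (M : ℕ) : Set ℍ :=
  {τ | ∃ q : SL(2, ℤ) ⧸ Gamma0 M, q.out • τ ∈ 𝒟}

/-- The normalised Petersson product at level `M`,
`⟨f, g⟩ = (SL₂(ℤ) : Γ₀(M))⁻¹ ∫ f(z) conj(g(z)) y ^ (k - 2) dx dy` over a fundamental domain of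
`Γ₀(M)`. The measure on `ℍ` is `dx dy / y ^ 2`, and `petersson k g f = conj g * f * y ^ k`. -/
def peterssonInner (M : ℕ) (k : ℤ) (f g : ℍ → ℂ) : ℂ :=
  ((Gamma0 M).index : ℂ)⁻¹ * ∫ τ in fundDomain M, petersson k g f τ

/-- The translate `(f | V_ℓ)(z) = f(ℓ z)`, for `ℓ ≥ 1`. -/
def translateV (ℓ : ℕ) (f : ℍ → ℂ) : ℍ → ℂ :=
  fun τ => f (ofComplex ((ℓ : ℂ) * (τ : ℂ)))

/-- `Γ₀(N)` as a subgroup of `GL₂(ℚ)`. -/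
def Gamma0Rat (N : ℕ) : Subgroup (GL (Fin 2) ℚ) :=
  (Gamma0 N).map (Matrix.SpecialLinearGroup.mapGL ℚ)

/-- The double coset `Γ₀(N) diag(ℓ, m) Γ₀(N)` in `GL₂(ℚ)`, for `ℓ, m ≥ 1`. -/
def heckeDoubleCoset (N ℓ m : ℕ) : Set (GL (Fin 2) ℚ) :=
  {g | ∃ γ₁ ∈ Gamma0Rat N, ∃ γ₂ ∈ Gamma0Rat N,
    (g : Matrix (Fin 2) (Fin 2) ℚ) = γ₁ * !![(ℓ : ℚ), 0; 0, (m : ℚ)] * γ₂}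

/-- The Hecke operator `T_N(ℓ, m)` on `S_k(Γ₀(N), χ)`, for `ℓ ∣ m` and `gcd(ℓ, N) = 1`:
if `Γ₀(N) diag(ℓ, m) Γ₀(N)` is the disjoint union of the cosets `Γ₀(N) α` then
`f | T_N(ℓ, m) = ∑ χ(a_α) det(α) ^ (k - 1) (c_α z + d_α) ^ (-k) f(α z)`.
Here `α = (a_α, b_α; c_α, d_α)` has integral entries, so that `a_α` is its own numerator, and
Mathlib's slash action contains the factor `det(α) ^ (k - 1)`. -/
def heckeT (N : ℕ) (χ : DirichletCharacter ℂ N) (k : ℤ) (ℓ m : ℕ) (f : ℍ → ℂ) : ℍ → ℂ :=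
  ∑ᶠ q ∈ (Quotient.mk (QuotientGroup.rightRel (Gamma0Rat N))) '' heckeDoubleCoset N ℓ m,
    χ (((q.out 0 0 : ℚ).num : ℤ) : ZMod N) •
      (f ∣[k] (Matrix.GeneralLinearGroup.map (algebraMap ℚ ℝ) q.out))

/-- Primitive forms (normalised newforms) of level `N` in `S_k(Γ₀(N), χ)`. -/
structure IsPrimitiveForm (N : ℕ) (χ : DirichletCharacter ℂ N) (k : ℤ) (f : ℍ → ℂ) : Prop where
  mem : f ∈ cuspFormSpace N χ k
  /-- `f` is orthogonal to all oldforms: to all translates `h | V_ℓ` of cusp forms `h` of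
  level `N'`, a proper divisor of `N`, whose character induces `χ`, with `ℓ N' ∣ N`. -/
  new : ∀ (N' : ℕ) (hN' : N' ∣ N), N' ≠ N → ∀ χ' : DirichletCharacter ℂ N',
    DirichletCharacter.changeLevel hN' χ' = χ → ∀ ℓ : ℕ, ℓ * N' ∣ N →
      ∀ h ∈ cuspFormSpace N' χ' k, peterssonInner N k f (translateV ℓ h) = 0
  /-- `f` is an eigenfunction of all Hecke operators. -/
  eigen : ∀ ℓ m : ℕ, 0 < m → ℓ ∣ m → ℓ.Coprime N → ∃ c : ℂ, heckeT N χ k ℓ m f = c • f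
  /-- The first Fourier coefficient of `f` is `1`. -/
  normalized : (qExpansion 1 f).coeff 1 = 1

/-- `f / √⟨f, f⟩` for `f` of level `N`. -/
def normalizedForm (N : ℕ) (k : ℤ) (f : ℍ → ℂ) : ℍ → ℂ :=
  ((Real.sqrt (peterssonInner N k f f).re : ℝ) : ℂ)⁻¹ • f

/-- `W_p(f)`: the span of `f | V_{p ^ j}` for `0 ≤ j ≤ r`. -/
def translateSpan (p r : ℕ) (f : ℍ → ℂ) : Submodule ℂ (ℍ → ℂ) :=
  Submodule.span ℂ (Set.range fun j : Fin (r + 1) => translateV (p ^ (j : ℕ)) f)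

/-- The real number `p ^ (j k / 2)`, as a complex number. -/
def halfPow (p : ℕ) (k : ℤ) (j : ℕ) : ℂ :=
  (((p : ℝ) ^ ((j : ℝ) * (k : ℝ) / 2) : ℝ) : ℂ)

open scoped ComplexConjugate in
/-- The functions `g_j` in the case `p ∣ N`; `F` is the form of norm one, and `lam` the
eigenvalue of `T(1, p)`. -/
def basisDvd (p : ℕ) (k : ℤ) (lam : ℂ) (F : ℍ → ℂ) : ℕ → ℍ → ℂ
  | 0 => F
  | j + 1 => halfPow p k (j + 1) •
      (translateV (p ^ (j + 1)) F - (conj lam / (p : ℂ) ^ k) • translateV (p ^ j) F)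

open scoped ComplexConjugate in
/-- The functions `g_j` in the case `p ∤ N`; `chip` is the value `χ(p)`. -/
def basisNotDvd (p : ℕ) (k : ℤ) (lam chip : ℂ) (F : ℍ → ℂ) : ℕ → ℍ → ℂ
  | 0 => F
  | 1 => halfPow p k 1 • translateV p F
      - (conj lam / (halfPow p k 1 * (1 + 1 / (p : ℂ)))) • F
  | j + 2 => halfPow p k (j + 2) •
      (translateV (p ^ (j + 2)) F - (conj lam / (p : ℂ) ^ k) • translateV (p ^ (j + 1)) F
        + (conj chip / (p : ℂ) ^ (k + 1)) • translateV (p ^ j) F)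

/-- `g` is a basis of `W` that is orthogonal for the Petersson product at level `M`. -/
structure IsOrthogonalBasis (M : ℕ) (k : ℤ) (W : Submodule ℂ (ℍ → ℂ)) {n : ℕ}
    (g : Fin n → ℍ → ℂ) : Prop where
  linearIndependent : LinearIndependent ℂ g
  span_eq : Submodule.span ℂ (Set.range g) = W
  orthogonal : ∀ i j, i ≠ j → peterssonInner M k (g i) (g j) = 0

end PrimitiveTranslates

end

/-! Scale f so that ⟨f, f⟩ = 1 and put c_n = ⟨f|V_{p^n}, f⟩. Up to the constant vol(𝒟), the
Petersson product is the mean of an invariant function over a fundamental domain. Such a mean does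
not change on passing to a subgroup of finite index (`setAverage_eq_of_le`), so the level does not
matter. A rational matrix a conjugates congruence subgroups into groups commensurable with SL₂(ℤ),
so the mean does not change under τ ↦ aτ either (`modularMean_comp_smul`). Hence ⟨u|a, v|a⟩ =
det(a)^(k-2) ⟨u, v⟩ when det(a) > 0 (`petPair_slash`). In particular V_p multiplies the product by
p^(-k), and the Gram matrix of the translates is determined by the c_n.

The double coset of T(1, p) has the representatives (1, j; 0, p), together with (p, 0; 0, 1) when p
∤ N. Pairing the eigenvalue equation with f|V_{p^n} gives (`petPair_translateV_succ`) p^k c_{n+1} =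
λ̄ c_n - χ̄(p) p^(k-1) ⟨f|V_{p^n}, f|V_p⟩. If p ∣ N, then χ(p) = 0 and c_n is a geometric sequence.
If p ∤ N, this is a linear recursion of order two for n ≥ 1; for n = 0 the relation conj c_1 = χ(p)
c_1 (`conj_petPair_translateV`) turns it into c_1 = λ̄ / (p^k (1 + 1/p)).

Apart from g_0, and from g_1 when p ∤ N, which is a Gram-Schmidt step, the coefficients of g_j are
those of the recursion. So g_j is orthogonal to f|V_{p^i} for all i < j. As g_j is triangular in the
translates, the g_j are orthogonal, and ⟨g_j, g_j⟩ = p^(jk/2) ⟨g_j, f|V_{p^j}⟩ for j ≥ 1 is an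
explicit sum of at most three terms. The translates are independent because a form with nonzero
first coefficient has only integral real periods (`exists_int_of_periodic`). -/

/-! ### Fundamental domains and means for commensurable groups -/

section FundamentalDomain

open scoped Pointwise

variable {P X : Type*} [Group P] [MulAction P X] [MeasurableSpace X] {μ : Measure X}
  [MeasurableConstSMul P X] [SMulInvariantMeasure P X μ]

/-- A fundamental domain for a subgroup from one for the group. -/
theorem isFundamentalDomain_iUnion_smul {K L : Subgroup P} (hLK : L ≤ K) {S : Set X}
    (hS : IsFundamentalDomain K S μ) {ι : Type*} [Countable ι] (s : ι → P) (hs : ∀ i, s i ∈ K)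
    (hu : ∀ g ∈ K, ∃! i, g * (s i)⁻¹ ∈ L) :
    IsFundamentalDomain L (⋃ i, s i • S) μ := by
  refine IsFundamentalDomain.mk'' ?_ ?_ ?_ ?_
  · exact NullMeasurableSet.iUnion fun i => hS.nullMeasurableSet.smul (s i)
  · filter_upwards [hS.ae_covers] with x hx
    obtain ⟨⟨g, hg⟩, hgx⟩ := hx
    obtain ⟨i, hi, -⟩ := hu g⁻¹ (inv_mem hg)
    refine ⟨⟨s i * g, by simpa using inv_mem hi⟩, Set.mem_iUnion.2 ⟨i, ?_⟩⟩
    change (s i * g) • x ∈ _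
    rw [mul_smul]
    exact Set.smul_mem_smul_set hgx
  · rintro ⟨l, hl⟩ hl1
    change AEDisjoint μ (l • _) _
    rw [Set.smul_set_iUnion]
    refine AEDisjoint.iUnion_left_iff.2 fun i => AEDisjoint.iUnion_right_iff.2 fun j => ?_
    rw [smul_smul]
    refine hS.aedisjoint (i := ⟨l * s i, mul_mem (hLK hl) (hs i)⟩) (j := ⟨s j, hs j⟩) ?_
    intro h
    have h' : l * s i = s j := congrArg Subtype.val h
    have hij : i = j := (hu (s j) (hs j)).unique (by simpa [← h'] using hl) (by simp)
    subst hij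
    exact hl1 (Subtype.ext (by simpa using h'))
  · intro g
    exact (measurePreserving_smul (g : P) μ).quasiMeasurePreserving

omit [MeasurableConstSMul P X] [SMulInvariantMeasure P X μ] in
theorem pairwise_aedisjoint_smul {K L : Subgroup P} {S : Set X}
    (hS : IsFundamentalDomain K S μ) {ι : Type*} (s : ι → P) (hs : ∀ i, s i ∈ K)
    (hu : ∀ g ∈ K, ∃! i, g * (s i)⁻¹ ∈ L) :
    Pairwise (Function.onFun (AEDisjoint μ) fun i => s i • S) := by
  intro i j hij
  refine hS.aedisjoint (i := ⟨s i, hs i⟩) (j := ⟨s j, hs j⟩) fun h => hij ?_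
  have h' : s i = s j := congrArg Subtype.val h
  exact (hu (s j) (hs j)).unique (by simp [h']) (by simp)

theorem measure_iUnion_smul {K L : Subgroup P} {S : Set X}
    (hS : IsFundamentalDomain K S μ) {ι : Type*} [Fintype ι] (s : ι → P) (hs : ∀ i, s i ∈ K)
    (hu : ∀ g ∈ K, ∃! i, g * (s i)⁻¹ ∈ L) :
    μ (⋃ i, s i • S) = Fintype.card ι * μ S := by
  rw [measure_iUnion₀ (pairwise_aedisjoint_smul hS s hs hu)
    fun i => hS.nullMeasurableSet.smul (s i)]
  simp [measure_smul, tsum_fintype]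

theorem setIntegral_smul_set (φ : X → ℂ) (g : P) (S : Set X) :
    ∫ x in g • S, φ x ∂μ = ∫ x in S, φ (g • x) ∂μ := by
  rw [← Set.image_smul]
  exact (measurePreserving_smul g μ).setIntegral_image_emb (measurableEmbedding_const_smul g) φ S

theorem setIntegral_iUnion_smul {K L : Subgroup P} {S : Set X}
    (hS : IsFundamentalDomain K S μ) {ι : Type*} [Fintype ι] (s : ι → P) (hs : ∀ i, s i ∈ K)
    (hu : ∀ g ∈ K, ∃! i, g * (s i)⁻¹ ∈ L) {φ : X → ℂ} (hφ : ∀ i, IntegrableOn φ (s i • S) μ) :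
    ∫ x in ⋃ i, s i • S, φ x ∂μ = ∑ i, ∫ x in S, φ (s i • x) ∂μ := by
  rw [integral_iUnion_ae (fun i => hS.nullMeasurableSet.smul (s i))
    (pairwise_aedisjoint_smul hS s hs hu) (integrableOn_finite_iUnion.2 hφ), tsum_fintype]
  simp_rw [setIntegral_smul_set]

/-- Inverses of representatives of left cosets. -/
theorem existsUnique_mul_out_mem (G : Type*) [Group G] (L : Subgroup G) (g : G) :
    ∃! q : G ⧸ L, g * q.out ∈ L := by
  refine ⟨(g⁻¹ : G), ?_, fun q hq => ?_⟩
  · have := QuotientGroup.mk_out_eq_mul L g⁻¹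
    obtain ⟨h, hh⟩ := this
    change g * ((g⁻¹ : G) : G ⧸ L).out ∈ L
    rw [hh]; simp
  · rw [← QuotientGroup.out_eq' q]
    exact (QuotientGroup.eq.2 (by simpa using hq)).symm

theorem existsUnique_mul_inv_out_mem {K L : Subgroup P} :
    ∀ g ∈ K, ∃! q : K ⧸ L.subgroupOf K, g * (((q.out : K) : P)⁻¹)⁻¹ ∈ L := by
  intro g hg
  have := existsUnique_mul_out_mem K (L.subgroupOf K) ⟨g, hg⟩
  simp only [Subgroup.mem_subgroupOf] at this
  simpa using this

/-- A fundamental domain of L is made of [K : L] translates of S, so integral and volume are both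
multiplied by the index, which cancels in the average. -/
theorem setAverage_eq_of_le {K L : Subgroup P} [Countable L] (hLK : L ≤ K)
    (hfin : L.relIndex K ≠ 0) {S T : Set X} (hS : IsFundamentalDomain K S μ)
    (hT : IsFundamentalDomain L T μ) {φ : X → ℂ}
    (hφ : IntegrableOn φ S μ) (hinv : ∀ g ∈ K, ∀ x, φ (g • x) = φ x) :
    ⨍ x in T, φ x ∂μ = ⨍ x in S, φ x ∂μ := by
  have : Finite (K ⧸ L.subgroupOf K) := by
    have : (L.subgroupOf K).FiniteIndex := ⟨hfin⟩
    infer_instance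
  have := Fintype.ofFinite (K ⧸ L.subgroupOf K)
  let s : (K ⧸ L.subgroupOf K) → P := fun q => ((q.out : K) : P)⁻¹
  have hs : ∀ i, s i ∈ K := fun i => inv_mem i.out.2
  have hu : ∀ g ∈ K, ∃! i, g * (s i)⁻¹ ∈ L := by
    exact existsUnique_mul_inv_out_mem
  have hU := isFundamentalDomain_iUnion_smul hLK hS s hs hu
  have hint : ∀ i, IntegrableOn φ (s i • S) μ := by
    intro i
    rw [← Set.image_smul, (measurePreserving_smul (s i) μ).integrableOn_image
      (measurableEmbedding_const_smul (s i))]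
    refine hφ.congr (Filter.Eventually.of_forall fun x => ?_)
    exact (hinv _ (hs i) x).symm
  have h1 : μ T = Fintype.card (K ⧸ L.subgroupOf K) * μ S := by
    rw [hT.measure_eq hU, measure_iUnion_smul hS s hs hu]
  have h2 : ∫ x in T, φ x ∂μ = Fintype.card (K ⧸ L.subgroupOf K) * ∫ x in S, φ x ∂μ := by
    rw [hT.setIntegral_eq hU (fun g x => hinv _ (hLK g.2) x),
      setIntegral_iUnion_smul hS s hs hu hint]
    simp [hinv _ (hs _)]
  have hc : (Fintype.card (K ⧸ L.subgroupOf K) : ℝ) ≠ 0 := by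
    exact_mod_cast Fintype.card_ne_zero
  rw [setAverage_eq, setAverage_eq, h2, measureReal_def, h1, measureReal_def]
  simp only [ENNReal.toReal_mul, ENNReal.toReal_natCast, mul_inv, Complex.real_smul]
  push_cast
  have hc' : (Fintype.card (K ⧸ L.subgroupOf K) : ℂ) ≠ 0 := by exact_mod_cast hc
  field_simp

/-- Averages of an invariant function over fundamental domains of commensurable groups agree. -/
theorem setAverage_eq_of_commensurable {K K' : Subgroup P} [Countable K] 
    (hfin : K.relIndex K' ≠ 0) (hfin' : K'.relIndex K ≠ 0) {S S' : Set X}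
    (hS : IsFundamentalDomain K S μ)
    (hS' : IsFundamentalDomain K' S' μ) {φ : X → ℂ}
    (hφ : IntegrableOn φ S μ) (hφ' : IntegrableOn φ S' μ)
    (hinv : ∀ g ∈ K, ∀ x, φ (g • x) = φ x) (hinv' : ∀ g ∈ K', ∀ x, φ (g • x) = φ x) :
    ⨍ x in S, φ x ∂μ = ⨍ x in S', φ x ∂μ := by
  have : Countable (K ⊓ K' : Subgroup P) :=
    (Subgroup.inclusion_injective (inf_le_left : K ⊓ K' ≤ K)).countable
  have h1 : (K ⊓ K').relIndex K ≠ 0 := by rwa [Subgroup.inf_relIndex_left]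
  have h2 : (K ⊓ K').relIndex K' ≠ 0 := by rwa [Subgroup.inf_relIndex_right]
  have hF : Finite (K ⧸ (K ⊓ K').subgroupOf K) := by
    have : ((K ⊓ K').subgroupOf K).FiniteIndex := ⟨h1⟩
    infer_instance
  let s : (K ⧸ (K ⊓ K').subgroupOf K) → P := fun q => ((q.out : K) : P)⁻¹
  -- Both averages are compared with the average over one fundamental domain of the intersection.
  have hU := isFundamentalDomain_iUnion_smul (inf_le_left : K ⊓ K' ≤ K) hS s
    (fun i => inv_mem i.out.2) existsUnique_mul_inv_out_mem
  rw [← setAverage_eq_of_le inf_le_left h1 hS hU hφ hinv,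
    setAverage_eq_of_le inf_le_right h2 hS' hU hφ' hinv']

end FundamentalDomain

/-! ### The faithful group of Möbius transformations -/

section MoebiusGroup

open scoped Pointwise

/-- The group of Möbius transformations of `ℍ`, acting faithfully. -/
abbrev MoebiusGroup : Type := (MulAction.toPermHom (GL (Fin 2) ℝ) ℍ).range

/-- The Möbius transformation of a matrix. -/
noncomputable def moebius : GL (Fin 2) ℝ →* MoebiusGroup :=
  (MulAction.toPermHom (GL (Fin 2) ℝ) ℍ).rangeRestrict

theorem moebius_surjective : Function.Surjective moebius := MonoidHom.rangeRestrict_surjective _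

/-- The Möbius transformation of an integral matrix. -/
noncomputable def moebiusSL : SL(2, ℤ) →* MoebiusGroup :=
  moebius.comp (Matrix.SpecialLinearGroup.mapGL ℝ)

theorem moebiusSL_smul (g : SL(2, ℤ)) (τ : ℍ) : moebiusSL g • τ = g • τ := rfl

instance : MeasurableConstSMul MoebiusGroup ℍ where
  measurable_const_smul c := by
    obtain ⟨g, rfl⟩ := moebius_surjective c
    exact measurable_const_smul g

instance : SMulInvariantMeasure MoebiusGroup ℍ volume where
  measure_preimage_smul c s hs := by
    obtain ⟨g, rfl⟩ := moebius_surjective c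
    exact measure_preimage_smul_of_nullMeasurableSet hs.nullMeasurableSet g

/-- Faithfulness is the reason for replacing matrices by transformations: -1 acts trivially, so a
set of positive measure is never a.e. disjoint from its translate by -1. -/
instance : FaithfulSMul MoebiusGroup ℍ := inferInstance

instance countable_SL2Z : Countable SL(2, ℤ) := by
  have : Countable (Matrix (Fin 2) (Fin 2) ℤ) := inferInstanceAs (Countable (Fin 2 → Fin 2 → ℤ))
  exact Subtype.countable

theorem moebiusSL_neg_one : moebiusSL (-1) = 1 := by
  refine eq_of_smul_eq_smul (α := ℍ) fun τ => ?_
  rw [moebiusSL_smul, one_smul, ModularGroup.SL_neg_smul, one_smul]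

/-- Only ±1 can carry a point of the open domain 𝒟ᵒ into 𝒟; a trivially acting matrix does so for
the point 2i. -/
theorem moebiusSL_eq_one_iff {g : SL(2, ℤ)} : moebiusSL g = 1 ↔ g = 1 ∨ g = -1 := by
  refine ⟨fun h => ?_, ?_⟩
  · have hne : (𝒟ᵒ : Set ℍ).Nonempty := by
      refine ⟨⟨2 * Complex.I, by simp⟩, ?_, ?_⟩
      · simp [Complex.normSq]; norm_num
      · simp [UpperHalfPlane.re]
    obtain ⟨z, hz⟩ := hne
    refine ModularGroup.eq_one_or_neg_one_of_mem_fdo_mem_fd hz ?_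
    rw [← moebiusSL_smul, h, one_smul]
    exact ModularGroup.fdo_subset_fd hz
  · rintro (rfl | rfl)
    · exact map_one _
    · exact moebiusSL_neg_one

end MoebiusGroup

/-! ### The hyperbolic volume of 𝒟 -/

section Volume

open scoped Pointwise ENNReal

theorem UpperHalfPlane.volume_eq_zero_of_image {s : Set ℍ}
    (h : volume (UpperHalfPlane.coe '' s) = 0) : volume s = 0 := by
  rw [UpperHalfPlane.volume_eq_lintegral]
  exact setLIntegral_measure_zero _ _ h

/-- The density y⁻² has no zeros. This lets a continuous function that vanishes almost everywhere be
recognised as zero in `petPair_self_ne_zero`. -/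
instance UpperHalfPlane.isOpenPosMeasure_volume : (volume : Measure ℍ).IsOpenPosMeasure where
  open_pos U hU hne h := by
    rw [UpperHalfPlane.volume_eq_lintegral] at h
    have hU' : IsOpen (UpperHalfPlane.coe '' U) := isOpenEmbedding_coe.isOpenMap _ hU
    rw [lintegral_eq_zero_iff (by fun_prop)] at h
    have h2 : ∀ᵐ z ∂(volume.restrict (UpperHalfPlane.coe '' U)), False := by
      filter_upwards [h, ae_restrict_mem hU'.measurableSet] with z hz hzU
      obtain ⟨τ, -, rfl⟩ := hzU
      simp [τ.im_ne_zero] at hz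
    have h3 : volume (UpperHalfPlane.coe '' U) = 0 := by
      simpa using h2
    exact (hU'.measure_pos volume (hne.image _)).ne' h3

theorem Complex.volume_re_eq (c : ℝ) : volume {z : ℂ | z.re = c} = 0 := by
  have h := Complex.volume_preserving_equiv_real_prod.measure_preimage_equiv ({c} ×ˢ Set.univ)
  have h2 : Complex.measurableEquivRealProd ⁻¹' ({c} ×ˢ Set.univ) = {z : ℂ | z.re = c} := by
    ext z; simp [Complex.measurableEquivRealProd]
  rw [h2] at h
  rw [h, Measure.volume_eq_prod, Measure.prod_prod]
  simp

/-- The boundary lies on the unit circle and two vertical lines, all null sets. -/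
theorem volume_fd_diff_fdo : volume (𝒟 \ 𝒟ᵒ) = 0 := by
  refine UpperHalfPlane.volume_eq_zero_of_image ?_
  refine measure_mono_null (t := Metric.sphere 0 1 ∪ ({z | z.re = 1 / 2} ∪ {z | z.re = -1 / 2})) ?_ ?_
  · rintro _ ⟨τ, ⟨h1, h2⟩, rfl⟩
    rw [ModularGroup.fd] at h1
    have h3 : ¬ (1 < Complex.normSq τ ∧ |τ.re| < 1 / 2) := h2
    obtain ⟨h4, h5⟩ := h1
    by_cases h6 : 1 < Complex.normSq τ
    · right
      have h7 : |τ.re| = 1 / 2 := le_antisymm h5 (not_lt.1 fun h => h3 ⟨h6, h⟩)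
      rcases abs_eq (by norm_num) |>.1 h7 with h | h
      · left; simpa using h
      · right; change (τ : ℂ).re = _ ; rw [UpperHalfPlane.coe_re, h]; norm_num
    · left
      have : Complex.normSq τ = 1 := le_antisymm (not_lt.1 h6) h4
      rw [mem_sphere_zero_iff_norm]
      rw [Complex.normSq_eq_norm_sq] at this
      nlinarith [norm_nonneg (τ : ℂ)]
  · simp [measure_union_null_iff, Complex.volume_re_eq, Measure.addHaar_sphere]

/-- On 𝒟 one has 4y² ≥ 3, so 𝒟 lies in the strip |x| ≤ 1, y > 1/2, over which y⁻² is integrable. -/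
theorem volume_fd_lt_top : volume (𝒟 : Set ℍ) < ∞ := by
  rw [UpperHalfPlane.volume_eq_lintegral]
  let R : Set (ℝ × ℝ) := Set.Icc (-1) 1 ×ˢ Set.Ioi (1 / 2)
  have hR : MeasurableSet R := measurableSet_Icc.prod measurableSet_Ioi
  have hsub : UpperHalfPlane.coe '' 𝒟 ⊆ Complex.measurableEquivRealProd ⁻¹' R := by
    rintro _ ⟨τ, hτ, rfl⟩
    have h1 := ModularGroup.three_le_four_mul_im_sq_of_mem_fd hτ
    have h2 : |τ.re| ≤ 1 / 2 := hτ.2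
    rw [abs_le] at h2
    simp only [R, Complex.measurableEquivRealProd, Set.mem_preimage, Set.mem_prod]
    refine ⟨⟨?_, ?_⟩, ?_⟩
    · simp; linarith
    · simp; linarith
    · simp; nlinarith [τ.im_pos]
  refine (lintegral_mono_set hsub).trans_lt ?_
  have h3 := Complex.volume_preserving_equiv_real_prod.setLIntegral_comp_preimage_emb
    Complex.measurableEquivRealProd.measurableEmbedding
    (fun x : ℝ × ℝ => (((1 / ‖x.2‖₊) ^ 2 : NNReal) : ℝ≥0∞)) R
  have h4 : ∀ z : ℂ, (Complex.measurableEquivRealProd z).2 = z.im := fun z => by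
    simp [Complex.measurableEquivRealProd]
  simp only [h4] at h3
  rw [h3, Measure.volume_eq_prod, ← Measure.prod_restrict, lintegral_prod _ (by fun_prop)]
  simp only [lintegral_const]
  refine ENNReal.mul_lt_top ?_ (by simp)
  have h5 : IntegrableOn (fun t : ℝ => t ^ (-2 : ℝ)) (Set.Ioi (1 / 2)) :=
    integrableOn_Ioi_rpow_of_lt (by norm_num) (by norm_num)
  refine lt_of_eq_of_lt ?_ h5.hasFiniteIntegral
  refine setLIntegral_congr_fun measurableSet_Ioi fun y hy => ?_
  have hy0 : (0 : ℝ) < y := lt_trans (by norm_num) hy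
  simp only [Real.rpow_neg hy0.le, enorm_eq_nnnorm, ENNReal.coe_inj]
  ext
  simp [abs_of_pos hy0]

theorem isFundamentalDomain_fd : IsFundamentalDomain moebiusSL.range (𝒟 : Set ℍ) volume := by
  refine IsFundamentalDomain.mk'' ModularGroup.isClosed_fd.measurableSet.nullMeasurableSet ?_ ?_ ?_
  · refine Filter.Eventually.of_forall fun τ => ?_
    obtain ⟨g, hg⟩ := ModularGroup.exists_smul_mem_fd τ
    exact ⟨⟨moebiusSL g, g, rfl⟩, hg⟩
  · rintro ⟨_, g, rfl⟩ h1
    refine measure_mono_null ?_ volume_fd_diff_fdo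
    rintro τ ⟨h2, h3⟩
    refine ⟨h3, fun h4 => h1 ?_⟩
    refine Subtype.ext ?_
    change moebiusSL g = 1
    rw [moebiusSL_eq_one_iff]
    have h5 : g⁻¹ • τ ∈ 𝒟 := by
      have := Set.mem_smul_set_iff_inv_smul_mem.1 h2
      change (moebiusSL g)⁻¹ • τ ∈ 𝒟 at this
      rwa [← map_inv, moebiusSL_smul] at this
    rcases ModularGroup.eq_one_or_neg_one_of_mem_fdo_mem_fd h4 h5 with h | h
    · left; simpa using h
    · right; rw [← inv_inv g, h]; simp
  · intro g
    exact (measurePreserving_smul (g : MoebiusGroup) volume).quasiMeasurePreserving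

theorem volume_fd_ne_zero : volume (𝒟 : Set ℍ) ≠ 0 := by
  have : Countable moebiusSL.range := moebiusSL.rangeRestrict_surjective.countable
  exact isFundamentalDomain_fd.measure_ne_zero (NeZero.ne _)

end Volume

/-! ### Fundamental domains of finite index subgroups -/

section Domain

open scoped Pointwise ENNReal

/-- The union of the translates of `𝒟` by representatives of the cosets of `Γ`. -/
def cosetDomain (Γ : Subgroup SL(2, ℤ)) : Set ℍ :=
  {τ | ∃ q : SL(2, ℤ) ⧸ Γ, q.out • τ ∈ 𝒟}

theorem fundDomain_eq_cosetDomain (M : ℕ) :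
    PrimitiveTranslates.fundDomain M = cosetDomain (Gamma0 M) := rfl

theorem cosetDomain_eq_iUnion (Γ : Subgroup SL(2, ℤ)) :
    cosetDomain Γ = ⋃ q : SL(2, ℤ) ⧸ Γ, (moebiusSL q.out)⁻¹ • (𝒟 : Set ℍ) := by
  ext τ
  simp [cosetDomain, Set.mem_inv_smul_set_iff, moebiusSL_smul]

variable {Γ : Subgroup SL(2, ℤ)}

/-- The kernel {±1} is contained in Γ, so no information is lost in the image. Hence cosets of Γ and
of its image correspond, and the index of Γ itself appears in the volume. -/
theorem moebiusSL_mem_map_iff (hΓ : -1 ∈ Γ) {g : SL(2, ℤ)} :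
    moebiusSL g ∈ Γ.map moebiusSL ↔ g ∈ Γ := by
  refine ⟨?_, fun h => ⟨g, h, rfl⟩⟩
  rintro ⟨h, hh, hhg⟩
  have h1 : moebiusSL (h⁻¹ * g) = 1 := by rw [map_mul, map_inv, hhg, inv_mul_cancel]
  have h2 : h⁻¹ * g ∈ Γ := by
    rcases moebiusSL_eq_one_iff.1 h1 with h | h
    · rw [h]; exact one_mem _
    · rw [h]; exact hΓ
  simpa using mul_mem hh h2

theorem existsUnique_mul_moebiusSL_out (hΓ : -1 ∈ Γ) :
    ∀ g ∈ moebiusSL.range, ∃! q : SL(2, ℤ) ⧸ Γ, g * ((moebiusSL q.out)⁻¹)⁻¹ ∈ Γ.map moebiusSL := by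
  rintro _ ⟨g, rfl⟩
  simp_rw [inv_inv, ← map_mul, moebiusSL_mem_map_iff hΓ]
  exact existsUnique_mul_out_mem _ Γ g

theorem map_moebiusSL_le_range (Γ : Subgroup SL(2, ℤ)) : Γ.map moebiusSL ≤ moebiusSL.range := by
  rintro _ ⟨g, -, rfl⟩
  exact ⟨g, rfl⟩

theorem isFundamentalDomain_cosetDomain (hΓ : -1 ∈ Γ) [Γ.FiniteIndex] :
    IsFundamentalDomain (Γ.map moebiusSL) (cosetDomain Γ) volume := by
  rw [cosetDomain_eq_iUnion]
  exact isFundamentalDomain_iUnion_smul (map_moebiusSL_le_range Γ) isFundamentalDomain_fd _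
    (fun q => inv_mem ⟨_, rfl⟩) (existsUnique_mul_moebiusSL_out hΓ)

theorem volume_cosetDomain (hΓ : -1 ∈ Γ) [Γ.FiniteIndex] :
    volume (cosetDomain Γ) = Γ.index * volume (𝒟 : Set ℍ) := by
  have := Fintype.ofFinite (SL(2, ℤ) ⧸ Γ)
  rw [cosetDomain_eq_iUnion, measure_iUnion_smul (L := Γ.map moebiusSL) isFundamentalDomain_fd _
    (fun q => inv_mem ⟨_, rfl⟩) (existsUnique_mul_moebiusSL_out hΓ), Subgroup.index,
    Nat.card_eq_fintype_card]

theorem volume_cosetDomain_lt_top (hΓ : -1 ∈ Γ) [Γ.FiniteIndex] :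
    volume (cosetDomain Γ) < ∞ := by
  rw [volume_cosetDomain hΓ]
  exact ENNReal.mul_lt_top (by simp) volume_fd_lt_top

end Domain

/-! ### The mean of an invariant function and its invariance under GL₂(ℚ) -/

section Mean

open scoped Pointwise ENNReal

/-- Bounded continuous functions on `ℍ` that are invariant under a congruence subgroup. -/
structure IsBoundedModular (φ : ℍ → ℂ) : Prop where
  continuous : Continuous φ
  bounded : ∃ C : ℝ, ∀ τ, ‖φ τ‖ ≤ C
  invariant : ∃ N ≠ 0, ∀ γ ∈ Gamma N, ∀ τ, φ (γ • τ) = φ τ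

/-- The subgroup of `SL(2, ℤ)` leaving `φ` invariant. -/
def invariantSubgroup (φ : ℍ → ℂ) : Subgroup SL(2, ℤ) where
  carrier := {γ | ∀ τ, φ (γ • τ) = φ τ}
  one_mem' τ := by rw [one_smul]
  mul_mem' {a b} ha hb τ := by rw [mul_smul, ha, hb]
  inv_mem' {a} ha τ := by rw [← ha, smul_inv_smul]

theorem neg_one_mem_invariantSubgroup (φ : ℍ → ℂ) : -1 ∈ invariantSubgroup φ := fun τ => by
  rw [ModularGroup.SL_neg_smul, one_smul]

/-- The mean of `φ` over a fundamental domain of the group leaving it invariant. -/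
noncomputable def modularMean (φ : ℍ → ℂ) : ℂ :=
  ⨍ τ in cosetDomain (invariantSubgroup φ), φ τ

/-- The action of a rational matrix on `ℍ` is that of its image in `GL(2, ℝ)`. -/
noncomputable abbrev realGL (a : GL (Fin 2) ℚ) : GL (Fin 2) ℝ :=
  Matrix.GeneralLinearGroup.map (algebraMap ℚ ℝ) a

theorem realGL_mapGL (γ : SL(2, ℤ)) :
    realGL (Matrix.SpecialLinearGroup.mapGL ℚ γ) = Matrix.SpecialLinearGroup.mapGL ℝ γ := by
  ext i j
  simp [realGL]

theorem Gamma_le_of_dvd {M N : ℕ} (h : M ∣ N) : Gamma N ≤ Gamma M := by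
  intro γ hγ
  rw [Gamma_mem] at hγ ⊢
  have h1 := fun (x : ZMod N) (y : ZMod N) (hxy : x = y) => congrArg (ZMod.castHom h (ZMod M)) hxy
  obtain ⟨a, b, c, d⟩ := hγ
  refine ⟨?_, ?_, ?_, ?_⟩
  · simpa only [map_intCast, map_one] using h1 _ _ a
  · simpa only [map_intCast, map_zero] using h1 _ _ b
  · simpa only [map_intCast, map_zero] using h1 _ _ c
  · simpa only [map_intCast, map_one] using h1 _ _ d

theorem Subgroup.relIndex_ne_zero_of_Gamma_le {N : ℕ} (hN : N ≠ 0) {H K : Subgroup MoebiusGroup}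
    (hH : (Gamma N).map moebiusSL ≤ H) (hK : K ≤ moebiusSL.range) : H.relIndex K ≠ 0 := by
  have : NeZero N := ⟨hN⟩
  have h1 : ((Gamma N).map moebiusSL).relIndex moebiusSL.range ≠ 0 := by
    have h0 : moebiusSL.range = Subgroup.map moebiusSL ⊤ := MonoidHom.range_eq_map _
    refine h0.symm ▸ ?_
    rw [Subgroup.relIndex_map_map]
    refine fun h => (Subgroup.FiniteIndex.index_ne_zero (H := Gamma N)) ?_
    have h2 := Subgroup.relIndex_dvd_of_le_left (⊤ ⊔ moebiusSL.ker)
      (le_sup_left : Gamma N ≤ Gamma N ⊔ moebiusSL.ker)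
    rw [h] at h2
    simpa using h2
  have h2 : H.relIndex moebiusSL.range ≠ 0 := fun h =>
    h1 (Subgroup.relIndex_eq_zero_of_le_left hH h)
  exact fun h => h2 (Subgroup.relIndex_eq_zero_of_le_right hK h)

variable {φ ψ : ℍ → ℂ}

namespace IsBoundedModular

theorem finiteIndex (hφ : IsBoundedModular φ) : (invariantSubgroup φ).FiniteIndex := by
  obtain ⟨N, hN, h⟩ := hφ.invariant
  have : NeZero N := ⟨hN⟩
  exact Subgroup.finiteIndex_of_le (H := Gamma N) h

theorem integrableOn (hφ : IsBoundedModular φ) {S : Set ℍ} (hS : volume S < ∞) :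
    IntegrableOn φ S := by
  obtain ⟨C, hC⟩ := hφ.bounded
  exact Measure.integrableOn_of_bounded hS.ne hφ.continuous.aestronglyMeasurable
    (Filter.Eventually.of_forall hC)

theorem add (hφ : IsBoundedModular φ) (hψ : IsBoundedModular ψ) : IsBoundedModular (φ + ψ) := by
  obtain ⟨C, hC⟩ := hφ.bounded
  obtain ⟨D, hD⟩ := hψ.bounded
  obtain ⟨N, hN, h⟩ := hφ.invariant
  obtain ⟨M, hM, h'⟩ := hψ.invariant
  refine ⟨hφ.continuous.add hψ.continuous, ⟨C + D, fun τ => ?_⟩, N * M, mul_ne_zero hN hM, ?_⟩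
  · exact (norm_add_le _ _).trans (add_le_add (hC τ) (hD τ))
  · intro γ hγ τ
    rw [Pi.add_apply, Pi.add_apply, h γ (Gamma_le_of_dvd (dvd_mul_right N M) hγ),
      h' γ (Gamma_le_of_dvd (dvd_mul_left M N) hγ)]

theorem smul (hφ : IsBoundedModular φ) (c : ℂ) : IsBoundedModular (c • φ) := by
  obtain ⟨C, hC⟩ := hφ.bounded
  obtain ⟨N, hN, h⟩ := hφ.invariant
  refine ⟨hφ.continuous.const_smul c, ⟨‖c‖ * C, fun τ => ?_⟩, N, hN, fun γ hγ τ => ?_⟩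
  · rw [Pi.smul_apply, norm_smul]
    exact mul_le_mul_of_nonneg_left (hC τ) (norm_nonneg c)
  · rw [Pi.smul_apply, Pi.smul_apply, h γ hγ]

/-- Invariance survives because some Γ(N') is conjugated into Γ(N) by a. -/
theorem comp_smul (hφ : IsBoundedModular φ) (a : GL (Fin 2) ℚ) :
    IsBoundedModular fun τ => φ (realGL a • τ) := by
  obtain ⟨C, hC⟩ := hφ.bounded
  obtain ⟨N, hN, h⟩ := hφ.invariant
  have : NeZero N := ⟨hN⟩
  obtain ⟨N', hN', h'⟩ := exists_Gamma_le_conj a N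
  refine ⟨hφ.continuous.comp (continuous_const_smul _), ⟨C, fun τ => hC _⟩, N', hN', ?_⟩
  intro γ hγ τ
  obtain ⟨δ, hδ, hδ'⟩ := h' γ hγ
  have h1 : (Matrix.SpecialLinearGroup.mapGL ℝ δ : GL (Fin 2) ℝ) * realGL a =
      realGL a * Matrix.SpecialLinearGroup.mapGL ℝ γ := by
    rw [← realGL_mapGL, ← realGL_mapGL, ← map_mul, ← map_mul, hδ']
    simp
  change φ (realGL a • (Matrix.SpecialLinearGroup.mapGL ℝ γ : GL (Fin 2) ℝ) • τ) = _
  rw [smul_smul, ← h1, mul_smul]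
  exact h δ hδ _

end IsBoundedModular

theorem countable_of_le_range {K : Subgroup MoebiusGroup} (hK : K ≤ moebiusSL.range) :
    Countable K := by
  have : Countable moebiusSL.range := moebiusSL.rangeRestrict_surjective.countable
  exact (Subgroup.inclusion_injective hK).countable

/-- This is independence of the level: the full invariance group may be replaced by any smaller
group of finite index containing -1. -/
theorem modularMean_eq (hφ : IsBoundedModular φ) {Γ : Subgroup SL(2, ℤ)} (hΓ : -1 ∈ Γ)
    [Γ.FiniteIndex] (hinv : ∀ γ ∈ Γ, ∀ τ, φ (γ • τ) = φ τ) :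
    modularMean φ = ⨍ τ in cosetDomain Γ, φ τ := by
  have := hφ.finiteIndex
  have : Countable (Γ.map moebiusSL) := countable_of_le_range (map_moebiusSL_le_range Γ)
  have hle : Γ ≤ invariantSubgroup φ := hinv
  refine (setAverage_eq_of_le (Subgroup.map_mono hle) ?_
    (isFundamentalDomain_cosetDomain (neg_one_mem_invariantSubgroup φ))
    (isFundamentalDomain_cosetDomain hΓ)
    (hφ.integrableOn (volume_cosetDomain_lt_top (neg_one_mem_invariantSubgroup φ))) ?_).symm
  · rw [Subgroup.relIndex_map_map]
    refine fun h => (Subgroup.FiniteIndex.index_ne_zero (H := Γ)) ?_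
    have h2 := Subgroup.relIndex_dvd_index_of_le
      (sup_le_sup_right hle moebiusSL.ker)
    rw [h] at h2
    have h3 := Subgroup.index_dvd_of_le (le_sup_left : Γ ≤ Γ ⊔ moebiusSL.ker)
    exact Nat.eq_zero_of_zero_dvd (h2.trans h3)
  · rintro _ ⟨γ, hγ, rfl⟩ τ
    exact hγ τ

theorem modularMean_add (hφ : IsBoundedModular φ) (hψ : IsBoundedModular ψ) :
    modularMean (φ + ψ) = modularMean φ + modularMean ψ := by
  have := hφ.finiteIndex
  have := hψ.finiteIndex
  have h1 : -1 ∈ invariantSubgroup φ ⊓ invariantSubgroup ψ :=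
    ⟨neg_one_mem_invariantSubgroup φ, neg_one_mem_invariantSubgroup ψ⟩
  rw [modularMean_eq hφ h1 fun γ hγ => hγ.1, modularMean_eq hψ h1 fun γ hγ => hγ.2,
    modularMean_eq (hφ.add hψ) h1 fun γ hγ τ => by
      rw [Pi.add_apply, Pi.add_apply, hγ.1, hγ.2]]
  have h2 := volume_cosetDomain_lt_top h1
  simp_rw [setAverage_eq, Pi.add_apply, ← smul_add]
  rw [integral_add (hφ.integrableOn h2) (hψ.integrableOn h2)]

theorem modularMean_smul (hφ : IsBoundedModular φ) (c : ℂ) :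
    modularMean (c • φ) = c * modularMean φ := by
  have := hφ.finiteIndex
  rw [modularMean_eq (hφ.smul c) (neg_one_mem_invariantSubgroup φ) fun γ hγ τ => by
      rw [Pi.smul_apply, Pi.smul_apply, hγ], modularMean]
  simp_rw [setAverage_eq, Pi.smul_apply]
  rw [integral_smul, smul_comm, smul_eq_mul]

open scoped ComplexConjugate in
theorem modularMean_conj (φ : ℍ → ℂ) :
    modularMean (fun τ => conj (φ τ)) = conj (modularMean φ) := by
  have h : invariantSubgroup (fun τ => conj (φ τ)) = invariantSubgroup φ := by
    ext γ
    exact forall_congr' fun τ => (starRingEnd ℂ).injective.eq_iff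
  rw [modularMean, modularMean, h]
  simp_rw [setAverage_eq, Complex.real_smul]
  rw [integral_conj]
  simp

/-- With m the transformation of a and K the invariance group of φ, the function ψ = φ ∘ m is
invariant under J = m⁻¹Km, which has the fundamental domain m⁻¹S. As m preserves the measure, the
mean of ψ over m⁻¹S is that of φ over S. It remains to see that J is commensurable with the integral
invariance group K' of ψ; each contains the image of a principal congruence subgroup up to
conjugation. -/
theorem modularMean_comp_smul (hφ : IsBoundedModular φ) (a : GL (Fin 2) ℚ) :
    modularMean (fun τ => φ (realGL a • τ)) = modularMean φ := by
  set ψ : ℍ → ℂ := fun τ => φ (realGL a • τ) with hψdef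
  have hψ : IsBoundedModular ψ := hφ.comp_smul a
  have := hφ.finiteIndex
  have := hψ.finiteIndex
  set m := moebius (realGL a) with hm
  set K := (invariantSubgroup φ).map moebiusSL
  set K' := (invariantSubgroup ψ).map moebiusSL
  have hK : K ≤ moebiusSL.range := map_moebiusSL_le_range _
  have hK' : K' ≤ moebiusSL.range := map_moebiusSL_le_range _
  set S := cosetDomain (invariantSubgroup φ)
  have hS : IsFundamentalDomain K S volume :=
    isFundamentalDomain_cosetDomain (neg_one_mem_invariantSubgroup φ)
  have hS' : IsFundamentalDomain K' (cosetDomain (invariantSubgroup ψ)) volume :=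
    isFundamentalDomain_cosetDomain (neg_one_mem_invariantSubgroup ψ)
  have hvS : volume S < ∞ := volume_cosetDomain_lt_top (neg_one_mem_invariantSubgroup φ)
  let J := K.map (MulAut.conj m⁻¹).toMonoidHom
  have hJ : IsFundamentalDomain J (m⁻¹ • S) volume := by
    let e : K ≃* J := K.equivMapOfInjective _ (MulAut.conj m⁻¹).injective
    have h1 : m⁻¹ • S = (fun τ : ℍ => m • τ) ⁻¹' S := (Set.preimage_smul m S).symm
    rw [h1]
    refine hS.preimage_of_equiv (measurePreserving_smul m volume).quasiMeasurePreserving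
      e.bijective fun g τ => ?_
    change m • ((e g : MoebiusGroup) • τ) = (g : MoebiusGroup) • m • τ
    have : (e g : MoebiusGroup) = m⁻¹ * g * m := by
      change (MulAut.conj m⁻¹) (g : MoebiusGroup) = _
      simp
    rw [this, smul_smul, smul_smul]
    congr 1
    group
  obtain ⟨N, hN, hNφ⟩ := hφ.invariant
  obtain ⟨N', hN', hNψ⟩ := hψ.invariant
  have : NeZero N := ⟨hN⟩
  have : NeZero N' := ⟨hN'⟩
  have hconj : ∀ (b : GL (Fin 2) ℚ) (L : ℕ) [NeZero L], ∃ L' ≠ 0,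
      (Gamma L').map moebiusSL ≤
        ((Gamma L).map moebiusSL).map (MulAut.conj (moebius (realGL b))⁻¹).toMonoidHom := by
    intro b L _
    obtain ⟨L', hL', h⟩ := exists_Gamma_le_conj b L
    refine ⟨L', hL', ?_⟩
    rintro _ ⟨x, hx, rfl⟩
    obtain ⟨y, hy, hxy⟩ := h x hx
    refine ⟨moebiusSL y, ⟨y, hy, rfl⟩, ?_⟩
    have h1 : (Matrix.SpecialLinearGroup.mapGL ℝ y : GL (Fin 2) ℝ) =
      realGL b * Matrix.SpecialLinearGroup.mapGL ℝ x * (realGL b)⁻¹ := by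
      rw [← realGL_mapGL, ← realGL_mapGL, ← map_mul, ← map_inv, ← map_mul, hxy]
    have h2 : moebiusSL y = moebius (realGL b) * moebiusSL x * (moebius (realGL b))⁻¹ := by
      simp only [moebiusSL, MonoidHom.comp_apply, h1, map_mul, map_inv]
    simp only [MulEquiv.coe_toMonoidHom, MulAut.conj_apply, h2]
    group
  have hidx : J.relIndex K' ≠ 0 := by
    obtain ⟨L', hL', h⟩ := hconj a N
    exact Subgroup.relIndex_ne_zero_of_Gamma_le hL'
      (h.trans (Subgroup.map_mono (Subgroup.map_mono hNφ))) hK'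
  have hidx' : K'.relIndex J ≠ 0 := by
    -- J need not consist of integral transformations, so the index is computed after conjugating
    -- both groups by m, which turns J into K.
    have h1 : K' = (K'.map (MulAut.conj m).toMonoidHom).map (MulAut.conj m⁻¹).toMonoidHom := by
      rw [Subgroup.map_map]
      have : (MulAut.conj m⁻¹).toMonoidHom.comp (MulAut.conj m).toMonoidHom = MonoidHom.id _ := by
        ext g : 1
        simp [MulAut.conj_apply, mul_assoc]
      rw [this, Subgroup.map_id]
    rw [h1, Subgroup.relIndex_map_map_of_injective _ _ (MulAut.conj m⁻¹).injective]
    obtain ⟨L', hL', h⟩ := hconj a⁻¹ N'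
    have h2 : (moebius (realGL a⁻¹))⁻¹ = m := by
      rw [hm, realGL, realGL, map_inv, map_inv, inv_inv]
    rw [h2] at h
    exact Subgroup.relIndex_ne_zero_of_Gamma_le hL'
      (h.trans (Subgroup.map_mono (Subgroup.map_mono hNψ))) hK
  have : Countable K' := countable_of_le_range hK'
  have hvol : volume (m⁻¹ • S) = volume S := measure_smul _ _ _
  rw [modularMean, setAverage_eq_of_commensurable hidx' hidx hS' hJ
    (hψ.integrableOn (volume_cosetDomain_lt_top (neg_one_mem_invariantSubgroup ψ)))
    (hψ.integrableOn (by rwa [hvol])), modularMean, setAverage_eq, setAverage_eq,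
    measureReal_def, hvol, setIntegral_smul_set, measureReal_def]
  · have : ∀ τ, ψ (m⁻¹ • τ) = φ τ := fun τ => by
      change φ (m • m⁻¹ • τ) = _
      rw [smul_inv_smul]
    simp_rw [this]
    rfl
  · rintro _ ⟨γ, hγ, rfl⟩ τ
    exact hγ τ
  · rintro _ ⟨_, ⟨γ, hγ, rfl⟩, rfl⟩ τ
    change φ (m • _) = φ (m • τ)
    simp only [MulEquiv.coe_toMonoidHom, MulAut.conj_apply, inv_inv, mul_smul, smul_inv_smul]
    exact hγ _

end Mean

/-! ### The Petersson product as a mean -/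

section Pairing

open scoped ComplexConjugate ENNReal

/-- Continuous functions `u` that are invariant in weight `k` under a congruence subgroup and for
which `|u| y ^ (k / 2)` is bounded. -/
structure IsBoundedSlash (k : ℤ) (u : ℍ → ℂ) : Prop where
  continuous : Continuous u
  bounded : ∃ C : ℝ, ∀ τ, ‖petersson k u u τ‖ ≤ C
  invariant : ∃ N ≠ 0, ∀ γ ∈ Gamma N, u ∣[k] γ = u

variable {k : ℤ} {u v w : ℍ → ℂ}

theorem petersson_self (k : ℤ) (u : ℍ → ℂ) (τ : ℍ) :
    petersson k u u τ = ((‖u τ‖ ^ 2 * τ.im ^ k : ℝ) : ℂ) := by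
  rw [petersson, Complex.conj_mul']
  push_cast
  rfl

theorem norm_petersson (k : ℤ) (u v : ℍ → ℂ) (τ : ℍ) :
    ‖petersson k u v τ‖ = ‖u τ‖ * ‖v τ‖ * τ.im ^ k := by
  simp [petersson, abs_of_pos τ.im_pos]

theorem norm_petersson_le (k : ℤ) (u v : ℍ → ℂ) (τ : ℍ) :
    ‖petersson k u v τ‖ ≤ ‖petersson k u u τ‖ + ‖petersson k v v τ‖ := by
  simp only [norm_petersson, ← add_mul]
  have : 0 < τ.im ^ k := zpow_pos τ.im_pos k
  refine mul_le_mul_of_nonneg_right ?_ this.le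
  nlinarith [sq_nonneg (‖u τ‖ - ‖v τ‖), sq_nonneg (‖u τ‖), sq_nonneg (‖v τ‖)]

theorem continuous_slash {g : GL (Fin 2) ℝ} (hg : 0 < g.det.val) (hu : Continuous u) :
    Continuous (u ∣[k] g) := by
  have h1 : u ∣[k] g = fun τ : ℍ => u (g • τ) * |g.det.val| ^ (k - 1) *
      ((g 1 0 : ℂ) * τ + g 1 1) ^ (-k) := by
    ext τ
    rw [ModularForm.slash_apply, σ, if_pos hg]
    rfl
  rw [h1]
  refine ((hu.comp (continuous_const_smul g)).mul continuous_const).mul ?_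
  refine Continuous.zpow₀ (by fun_prop) _ fun τ => Or.inl ?_
  exact denom_ne_zero g τ

theorem petersson_slash_pos {g : GL (Fin 2) ℝ} (hg : 0 < g.det.val) (u v : ℍ → ℂ) (τ : ℍ) :
    petersson k (u ∣[k] g) (v ∣[k] g) τ = (g.det.val : ℂ) ^ (k - 2) * petersson k u v (g • τ) := by
  rw [petersson_slash, σ, if_pos hg, abs_of_pos hg]
  rfl

theorem realGL_det (a : GL (Fin 2) ℚ) : (realGL a).det.val = ((a.det.val : ℚ) : ℝ) := by
  simp [realGL, Matrix.det_fin_two]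

theorem realGL_det_pos {a : GL (Fin 2) ℚ} (ha : 0 < a.det.val) : 0 < (realGL a).det.val := by
  rw [realGL_det]
  exact_mod_cast ha

namespace IsBoundedSlash

theorem isBoundedModular (hu : IsBoundedSlash k u) (hv : IsBoundedSlash k v) :
    IsBoundedModular (petersson k v u) := by
  obtain ⟨C, hC⟩ := hu.bounded
  obtain ⟨D, hD⟩ := hv.bounded
  obtain ⟨N, hN, h⟩ := hu.invariant
  obtain ⟨M, hM, h'⟩ := hv.invariant
  refine ⟨petersson_continuous k hv.continuous hu.continuous,
    ⟨D + C, fun τ => (norm_petersson_le k v u τ).trans (add_le_add (hD τ) (hC τ))⟩,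
    N * M, mul_ne_zero hN hM, fun γ hγ τ => ?_⟩
  rw [← petersson_slash_SL, h γ (Gamma_le_of_dvd (dvd_mul_right N M) hγ),
    h' γ (Gamma_le_of_dvd (dvd_mul_left M N) hγ)]

theorem add (hu : IsBoundedSlash k u) (hv : IsBoundedSlash k v) : IsBoundedSlash k (u + v) := by
  obtain ⟨C, hC⟩ := hu.bounded
  obtain ⟨D, hD⟩ := hv.bounded
  obtain ⟨N, hN, h⟩ := hu.invariant
  obtain ⟨M, hM, h'⟩ := hv.invariant
  refine ⟨hu.continuous.add hv.continuous, ⟨2 * (C + D), fun τ => ?_⟩, N * M,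
    mul_ne_zero hN hM, fun γ hγ => ?_⟩
  · refine le_trans ?_ (mul_le_mul_of_nonneg_left (add_le_add (hC τ) (hD τ)) zero_le_two)
    simp only [norm_petersson, ← add_mul, ← mul_assoc]
    have : 0 < τ.im ^ k := zpow_pos τ.im_pos k
    refine mul_le_mul_of_nonneg_right ?_ this.le
    have h1 : ‖(u + v) τ‖ ≤ ‖u τ‖ + ‖v τ‖ := norm_add_le _ _
    nlinarith [sq_nonneg (‖u τ‖ - ‖v τ‖), norm_nonneg ((u + v) τ), norm_nonneg (u τ),
      norm_nonneg (v τ)]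
  · rw [SlashAction.add_slash, h γ (Gamma_le_of_dvd (dvd_mul_right N M) hγ),
      h' γ (Gamma_le_of_dvd (dvd_mul_left M N) hγ)]

theorem smul (hu : IsBoundedSlash k u) (c : ℂ) : IsBoundedSlash k (c • u) := by
  obtain ⟨C, hC⟩ := hu.bounded
  obtain ⟨N, hN, h⟩ := hu.invariant
  refine ⟨hu.continuous.const_smul c, ⟨‖c‖ ^ 2 * C, fun τ => ?_⟩, N, hN, fun γ hγ => ?_⟩
  · refine le_trans (le_of_eq ?_) (mul_le_mul_of_nonneg_left (hC τ) (sq_nonneg ‖c‖))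
    simp only [norm_petersson, Pi.smul_apply, norm_smul]
    ring
  · rw [ModularForm.SL_smul_slash, h γ hγ]

theorem zero (k : ℤ) : IsBoundedSlash k 0 :=
  ⟨continuous_zero, ⟨0, fun τ => by simp [petersson]⟩, 1, one_ne_zero,
    fun γ _ => SlashAction.zero_slash k γ⟩

theorem sum {ι : Type*} (s : Finset ι) {U : ι → ℍ → ℂ} (hU : ∀ i, IsBoundedSlash k (U i)) :
    IsBoundedSlash k (∑ i ∈ s, U i) := by
  classical
  induction s using Finset.induction_on with
  | empty => simpa using zero k
  | insert i s hi ih => rw [Finset.sum_insert hi]; exact (hU i).add ih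

theorem slash (hu : IsBoundedSlash k u) {a : GL (Fin 2) ℚ} (ha : 0 < a.det.val) :
    IsBoundedSlash k (u ∣[k] realGL a) := by
  obtain ⟨C, hC⟩ := hu.bounded
  obtain ⟨N, hN, h⟩ := hu.invariant
  have : NeZero N := ⟨hN⟩
  obtain ⟨N', hN', h'⟩ := exists_Gamma_le_conj a N
  have hpos := realGL_det_pos ha
  refine ⟨continuous_slash hpos hu.continuous,
    ⟨‖((realGL a).det.val : ℂ) ^ (k - 2)‖ * C, fun τ => ?_⟩, N', hN', fun γ hγ => ?_⟩
  · rw [petersson_slash_pos hpos, norm_mul]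
    exact mul_le_mul_of_nonneg_left (hC _) (norm_nonneg _)
  · obtain ⟨δ, hδ, hδ'⟩ := h' γ hγ
    have h1 : realGL a * Matrix.SpecialLinearGroup.mapGL ℝ γ =
        (Matrix.SpecialLinearGroup.mapGL ℝ δ : GL (Fin 2) ℝ) * realGL a := by
      rw [← realGL_mapGL, ← realGL_mapGL, ← map_mul, ← map_mul, hδ']
      simp
    change (u ∣[k] realGL a) ∣[k] (Matrix.SpecialLinearGroup.mapGL ℝ γ : GL (Fin 2) ℝ) = _
    rw [← SlashAction.slash_mul, h1, SlashAction.slash_mul]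
    congr 1
    exact h δ hδ

end IsBoundedSlash

/-- The Petersson product, normalised so that it does not depend on a level. -/
noncomputable def petPair (k : ℤ) (u v : ℍ → ℂ) : ℂ :=
  (volume.real (𝒟 : Set ℍ) : ℂ) * modularMean (petersson k v u)

theorem neg_one_mem_Gamma0 (M : ℕ) : -1 ∈ Gamma0 M := by
  simp [Gamma0_mem]

/-- The domain of Γ₀(M) has volume index · vol(𝒟), so dividing by the index instead of by the volume
changes the mean by the factor vol(𝒟), whatever M is. -/
theorem peterssonInner_eq_petPair (M : ℕ) [NeZero M] (hu : IsBoundedSlash k u)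
    (hv : IsBoundedSlash k v)
    (hinv : ∀ γ ∈ Gamma0 M, ∀ τ, petersson k v u (γ • τ) = petersson k v u τ) :
    PrimitiveTranslates.peterssonInner M k u v = petPair k u v := by
  have h1 : ((Gamma0 M).index : ℂ) ≠ 0 := by
    exact_mod_cast Subgroup.FiniteIndex.index_ne_zero
  have h2 : (volume.real (𝒟 : Set ℍ) : ℂ) ≠ 0 := by
    exact_mod_cast (ENNReal.toReal_pos volume_fd_ne_zero volume_fd_lt_top.ne).ne'
  rw [PrimitiveTranslates.peterssonInner, petPair,
    modularMean_eq (hu.isBoundedModular hv) (neg_one_mem_Gamma0 M) hinv, setAverage_eq,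
    measureReal_def (s := cosetDomain _), volume_cosetDomain (neg_one_mem_Gamma0 M),
    fundDomain_eq_cosetDomain, ENNReal.toReal_mul, ENNReal.toReal_natCast, ← measureReal_def,
    Complex.real_smul]
  push_cast
  field_simp

theorem petPair_add_left (hu : IsBoundedSlash k u) (hv : IsBoundedSlash k v)
    (hw : IsBoundedSlash k w) : petPair k (u + v) w = petPair k u w + petPair k v w := by
  have h : petersson k w (u + v) = petersson k w u + petersson k w v := by
    ext τ; simp only [petersson, Pi.add_apply]; ring
  rw [petPair, h, modularMean_add (hu.isBoundedModular hw) (hv.isBoundedModular hw), mul_add]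
  rfl

theorem petPair_smul_left (hu : IsBoundedSlash k u) (hw : IsBoundedSlash k w) (c : ℂ) :
    petPair k (c • u) w = c * petPair k u w := by
  have h : petersson k w (c • u) = c • petersson k w u := by
    ext τ; simp only [petersson, Pi.smul_apply, smul_eq_mul]; ring
  rw [petPair, h, modularMean_smul (hu.isBoundedModular hw), petPair]
  ring

theorem petPair_conj (k : ℤ) (u v : ℍ → ℂ) : conj (petPair k u v) = petPair k v u := by
  rw [petPair, petPair, map_mul, Complex.conj_ofReal, ← modularMean_conj]
  congr 2
  ext τ
  rw [petersson_symm k v u]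

theorem petPair_add_right (hu : IsBoundedSlash k u) (hv : IsBoundedSlash k v)
    (hw : IsBoundedSlash k w) : petPair k u (v + w) = petPair k u v + petPair k u w := by
  rw [← petPair_conj, petPair_add_left hv hw hu, map_add, petPair_conj, petPair_conj]

theorem petPair_smul_right (hu : IsBoundedSlash k u) (hv : IsBoundedSlash k v) (c : ℂ) :
    petPair k u (c • v) = conj c * petPair k u v := by
  rw [← petPair_conj, petPair_smul_left hv hu, map_mul, petPair_conj]

theorem petPair_sub_left (hu : IsBoundedSlash k u) (hv : IsBoundedSlash k v)
    (hw : IsBoundedSlash k w) : petPair k (u - v) w = petPair k u w - petPair k v w := by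
  have h : u - v = u + (-1 : ℂ) • v := by simp [sub_eq_add_neg]
  rw [h, petPair_add_left hu (hv.smul _) hw, petPair_smul_left hv hw]
  ring

theorem petPair_sub_right (hu : IsBoundedSlash k u) (hv : IsBoundedSlash k v)
    (hw : IsBoundedSlash k w) : petPair k u (v - w) = petPair k u v - petPair k u w := by
  rw [← petPair_conj, petPair_sub_left hv hw hu, map_sub, petPair_conj, petPair_conj]

theorem petPair_sum_right {ι : Type*} (s : Finset ι) (hu : IsBoundedSlash k u)
    {V : ι → ℍ → ℂ} (hV : ∀ i, IsBoundedSlash k (V i)) :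
    petPair k u (∑ i ∈ s, V i) = ∑ i ∈ s, petPair k u (V i) := by
  classical
  induction s using Finset.induction_on with
  | empty =>
    have := petPair_smul_right hu hu 0
    simpa using this
  | insert i s hi ih =>
    rw [Finset.sum_insert hi, Finset.sum_insert hi,
      petPair_add_right hu (hV i) (IsBoundedSlash.sum s hV), ih]

/-- The two slash factors give det^(2(k-1)), and Im(aτ) = det(a) Im(τ)/|cτ + d|² takes away det^k.
What remains is the invariance of the mean under a. -/
theorem petPair_slash (hu : IsBoundedSlash k u) (hv : IsBoundedSlash k v) {a : GL (Fin 2) ℚ}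
    (ha : 0 < a.det.val) : petPair k (u ∣[k] realGL a) (v ∣[k] realGL a) =
      ((a.det.val : ℚ) : ℂ) ^ (k - 2) * petPair k u v := by
  have h : petersson k (v ∣[k] realGL a) (u ∣[k] realGL a) =
      (((a.det.val : ℚ) : ℂ) ^ (k - 2)) • fun τ => petersson k v u (realGL a • τ) := by
    ext τ
    rw [petersson_slash_pos (realGL_det_pos ha), realGL_det]
    simp
  rw [petPair, h, modularMean_smul ((hu.isBoundedModular hv).comp_smul a),
    modularMean_comp_smul (hu.isBoundedModular hv), petPair]
  ring

theorem exists_petPair_self (k : ℤ) (u : ℍ → ℂ) : ∃ x : ℝ, 0 ≤ x ∧ petPair k u u = x := by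
  refine ⟨volume.real (𝒟 : Set ℍ) *
    ⨍ τ in cosetDomain (invariantSubgroup (petersson k u u)), ‖u τ‖ ^ 2 * τ.im ^ k, ?_, ?_⟩
  · refine mul_nonneg measureReal_nonneg (integral_nonneg fun τ => ?_)
    have : 0 < τ.im ^ k := zpow_pos τ.im_pos k
    positivity
  · rw [petPair, modularMean, Complex.ofReal_mul]
    congr 1
    simp_rw [petersson_self]
    rw [setAverage_eq, setAverage_eq, integral_complex_ofReal]
    simp

/-- If the mean of the nonnegative function |u|² y^k is zero, the function vanishes a.e. on the
domain, by invariance a.e. on ℍ, and by continuity everywhere. -/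
theorem petPair_self_ne_zero (hu : IsBoundedSlash k u) (h0 : u ≠ 0) : petPair k u u ≠ 0 := by
  have hφ := hu.isBoundedModular hu
  set φ := petersson k u u with hφdef
  have := hφ.finiteIndex
  have hn := neg_one_mem_invariantSubgroup φ
  intro h
  have h2 : (volume.real (𝒟 : Set ℍ) : ℂ) ≠ 0 := by
    exact_mod_cast (ENNReal.toReal_pos volume_fd_ne_zero volume_fd_lt_top.ne).ne'
  have h3 := (mul_eq_zero.1 h).resolve_left h2
  rw [modularMean, setAverage_eq, smul_eq_zero] at h3
  have hS : volume.real (cosetDomain (invariantSubgroup φ)) ≠ 0 := by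
    rw [measureReal_def, volume_cosetDomain hn, ENNReal.toReal_mul]
    refine mul_ne_zero ?_ (ENNReal.toReal_pos volume_fd_ne_zero volume_fd_lt_top.ne).ne'
    simpa using Subgroup.FiniteIndex.index_ne_zero
  have h4 := h3.resolve_left (inv_ne_zero hS)
  have hint := hφ.integrableOn (volume_cosetDomain_lt_top hn)
  have hnn : ∀ τ : ℍ, 0 ≤ ‖u τ‖ ^ 2 * τ.im ^ k := fun τ => by
    have : 0 < τ.im ^ k := zpow_pos τ.im_pos k
    positivity
  have h5 : (fun τ : ℍ => ‖u τ‖ ^ 2 * τ.im ^ k) =ᵐ[volume.restrict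
      (cosetDomain (invariantSubgroup φ))] 0 := by
    rw [← integral_eq_zero_iff_of_nonneg hnn]
    · have h6 : ∫ τ in cosetDomain (invariantSubgroup φ), φ τ =
          ((∫ τ in cosetDomain (invariantSubgroup φ), ‖u τ‖ ^ 2 * τ.im ^ k : ℝ) : ℂ) := by
        rw [← integral_complex_ofReal]
        exact integral_congr_ae (Filter.Eventually.of_forall fun τ => petersson_self k u τ)
      rw [h6] at h4
      exact_mod_cast h4
    · have := hint.norm
      refine this.congr (Filter.Eventually.of_forall fun τ => ?_)
      change ‖φ τ‖ = _
      rw [hφdef, norm_petersson]; ring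
  have hFD := isFundamentalDomain_cosetDomain hn
  have hK : Countable ((invariantSubgroup φ).map moebiusSL) :=
    countable_of_le_range (map_moebiusSL_le_range _)
  have h7 : volume {τ | φ τ ≠ 0} = 0 := by
    refine hFD.measure_zero_of_invariant _ ?_ ?_
    · rintro ⟨_, γ, hγ, rfl⟩
      ext τ
      rw [Set.mem_smul_set_iff_inv_smul_mem]
      change φ ((moebiusSL γ)⁻¹ • τ) ≠ 0 ↔ φ τ ≠ 0
      rw [← map_inv, moebiusSL_smul, inv_mem hγ τ]
    · have h8 : ∀ᵐ τ ∂volume.restrict (cosetDomain (invariantSubgroup φ)), φ τ = 0 := by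
        filter_upwards [h5] with τ hτ
        rw [hφdef, petersson_self]
        exact_mod_cast hτ
      have h9 : MeasurableSet {τ | φ τ ≠ 0} :=
        (isOpen_ne_fun hφ.continuous continuous_const).measurableSet
      rwa [ae_iff, Measure.restrict_apply h9] at h8
  have h8 : φ =ᵐ[volume] 0 := h7
  have h9 : φ = 0 := (hφ.continuous.ae_eq_iff_eq volume continuous_zero).1 h8
  refine h0 (funext fun τ => ?_)
  have h10 := congrFun h9 τ
  rw [hφdef, petersson_self] at h10
  have h11 : ‖u τ‖ ^ 2 * τ.im ^ k = 0 := Complex.ofReal_eq_zero.1 h10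
  have : τ.im ^ k ≠ 0 := (zpow_pos τ.im_pos k).ne'
  simpa [this] using h11

end Pairing

/-! ### Slashing by triangular matrices; the translates V_ℓ -/

section Triangular

/-- The rational matrix `(a, b; 0, d)`. -/
noncomputable def triGL (a b d : ℚ) (h : a * d ≠ 0) : GL (Fin 2) ℚ :=
  Matrix.GeneralLinearGroup.mkOfDetNeZero !![a, b; 0, d] (by simpa [Matrix.det_fin_two] using h)

variable {a b d : ℚ}

theorem triGL_val (h : a * d ≠ 0) :
    (triGL a b d h : Matrix (Fin 2) (Fin 2) ℚ) = !![a, b; 0, d] := rfl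

theorem triGL_det (h : a * d ≠ 0) : (triGL a b d h).det.val = a * d := by
  rw [Matrix.GeneralLinearGroup.val_det_apply, triGL_val]
  simp [Matrix.det_fin_two]

theorem slash_triGL (k : ℤ) (u : ℍ → ℂ) (h : 0 < a * d) (τ : ℍ) :
    (u ∣[k] realGL (triGL a b d h.ne')) τ =
      ((a : ℂ) * d) ^ (k - 1) * (d : ℂ) ^ (-k) * u (ofComplex ((a * τ + b) / d)) := by
  have hdet : 0 < (realGL (triGL a b d h.ne')).det.val :=
    realGL_det_pos (by rw [triGL_det]; exact h)
  have h2 : ((realGL (triGL a b d h.ne') • τ : ℍ) : ℂ) = (a * τ + b) / d := by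
    rw [UpperHalfPlane.coe_smul_of_det_pos hdet, UpperHalfPlane.num, UpperHalfPlane.denom]
    simp [realGL, triGL_val]
  rw [← h2, ofComplex_apply, ModularForm.slash_apply, σ, if_pos hdet, abs_of_pos hdet, realGL_det,
    triGL_det]
  simp only [UpperHalfPlane.denom, realGL, Matrix.GeneralLinearGroup.map_apply, triGL_val]
  simp
  ring

/-- The integral matrix `(a, b; c, d)` of determinant one. -/
def intSL (a b c d : ℤ) (h : a * d - b * c = 1) : SL(2, ℤ) :=
  ⟨!![a, b; c, d], by rw [Matrix.det_fin_two_of]; exact h⟩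

@[simp] theorem intSL_coe (a b c d : ℤ) (h : a * d - b * c = 1) :
    (intSL a b c d h : Matrix (Fin 2) (Fin 2) ℤ) = !![a, b; c, d] := rfl

theorem translateV_one (f : ℍ → ℂ) : PrimitiveTranslates.translateV 1 f = f := by
  ext τ
  simp [PrimitiveTranslates.translateV, ofComplex_apply]

/-- The rational matrix `(ℓ, 0; 0, 1)`. -/
noncomputable abbrev diagGL (ℓ : ℕ) [NeZero ℓ] : GL (Fin 2) ℚ :=
  triGL ℓ 0 1 (by simp [NeZero.ne ℓ])

theorem diagGL_det (ℓ : ℕ) [NeZero ℓ] : (diagGL ℓ).det.val = ℓ := by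
  rw [diagGL, triGL_det, mul_one]

theorem diagGL_det_pos (ℓ : ℕ) [NeZero ℓ] : 0 < (diagGL ℓ).det.val := by
  rw [diagGL_det]
  exact_mod_cast Nat.pos_of_ne_zero (NeZero.ne ℓ)

theorem slash_diagGL (k : ℤ) (ℓ : ℕ) [NeZero ℓ] (u : ℍ → ℂ) :
    u ∣[k] realGL (diagGL ℓ) = (ℓ : ℂ) ^ (k - 1) • PrimitiveTranslates.translateV ℓ u := by
  ext τ
  have h : (0 : ℚ) < (ℓ : ℚ) * 1 := by
    rw [mul_one]; exact_mod_cast Nat.pos_of_ne_zero (NeZero.ne ℓ)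
  rw [slash_triGL k u h]
  simp [PrimitiveTranslates.translateV]

theorem translateV_eq_slash (k : ℤ) (ℓ : ℕ) [NeZero ℓ] (u : ℍ → ℂ) :
    PrimitiveTranslates.translateV ℓ u = (ℓ : ℂ) ^ (1 - k) • (u ∣[k] realGL (diagGL ℓ)) := by
  have h : (ℓ : ℂ) ≠ 0 := by exact_mod_cast NeZero.ne ℓ
  rw [slash_diagGL, smul_smul, ← zpow_add₀ h]
  simp

theorem translateV_mul (ℓ m : ℕ) [NeZero ℓ] [NeZero m] (u : ℍ → ℂ) :
    PrimitiveTranslates.translateV ℓ (PrimitiveTranslates.translateV m u) =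
      PrimitiveTranslates.translateV (ℓ * m) u := by
  ext τ
  have h : 0 < ((ℓ : ℂ) * τ).im := by
    have := τ.im_pos
    have hℓ : (0 : ℝ) < ℓ := by exact_mod_cast Nat.pos_of_ne_zero (NeZero.ne ℓ)
    simp [this, hℓ]
  simp only [PrimitiveTranslates.translateV]
  rw [ofComplex_apply_of_im_pos h]
  congr 2
  push_cast
  ring

theorem translateV_smul (ℓ : ℕ) (c : ℂ) (u : ℍ → ℂ) :
    PrimitiveTranslates.translateV ℓ (c • u) = c • PrimitiveTranslates.translateV ℓ u := rfl

theorem IsBoundedSlash.translateV {k : ℤ} {u : ℍ → ℂ} (hu : IsBoundedSlash k u) (ℓ : ℕ) [NeZero ℓ] :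
    IsBoundedSlash k (PrimitiveTranslates.translateV ℓ u) := by
  rw [translateV_eq_slash k]
  exact (hu.slash (diagGL_det_pos ℓ)).smul _

end Triangular

/-! ### Cusp forms with character and the levels of their translates -/

section CuspForms

open PrimitiveTranslates

variable {N : ℕ} {χ : DirichletCharacter ℂ N} {k : ℤ} {f : ℍ → ℂ}

theorem isCoprime_of_mem_Gamma0 {γ : SL(2, ℤ)} (h : γ ∈ Gamma0 N) : IsCoprime (γ 1 1) (N : ℤ) := by
  have h1 : (N : ℤ) ∣ γ 1 0 := (ZMod.intCast_zmod_eq_zero_iff_dvd _ _).1 h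
  obtain ⟨c, hc⟩ := h1
  have h2 := γ.det_coe
  rw [Matrix.det_fin_two] at h2
  refine ⟨γ 0 0, - γ 0 1 * c, ?_⟩
  rw [hc] at h2
  linear_combination h2

theorem isUnit_of_mem_Gamma0 {γ : SL(2, ℤ)} (h : γ ∈ Gamma0 N) :
    IsUnit ((γ 1 1 : ℤ) : ZMod N) := by
  rw [← ZMod.coe_unitOfIsCoprime _ (isCoprime_of_mem_Gamma0 h)]
  exact Units.isUnit _

theorem norm_apply_of_mem_Gamma0 [NeZero N] (χ : DirichletCharacter ℂ N) {γ : SL(2, ℤ)}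
    (h : γ ∈ Gamma0 N) : ‖χ ((γ 1 1 : ℤ) : ZMod N)‖ = 1 := by
  obtain ⟨u, hu⟩ := isUnit_of_mem_Gamma0 h
  rw [← hu]
  exact χ.unit_norm_eq_one u

theorem isBoundedSlash_of_mem [NeZero N] (hf : f ∈ cuspFormSpace N χ k) : IsBoundedSlash k f := by
  obtain ⟨⟨F, rfl⟩, h⟩ := hf
  refine ⟨F.holo'.continuous, CuspFormClass.petersson_bounded_left k _ F F, N, NeZero.ne N, ?_⟩
  intro γ hγ
  refine SlashInvariantFormClass.slash_action_eq F _ ⟨γ, ?_, rfl⟩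
  rw [Gamma_mem] at hγ
  exact (Gamma1_mem N γ).2 ⟨hγ.1, hγ.2.2.2, hγ.2.2.1⟩

/-- The character value has modulus one and meets its own conjugate. -/
theorem petersson_smul_of_mem [NeZero N] {g : ℍ → ℂ} (hf : f ∈ cuspFormSpace N χ k)
    (hg : g ∈ cuspFormSpace N χ k) {γ : SL(2, ℤ)} (hγ : γ ∈ Gamma0 N) (τ : ℍ) :
    petersson k g f (γ • τ) = petersson k g f τ := by
  rw [← petersson_slash_SL, hf.2 γ hγ, hg.2 γ hγ]
  have h := norm_apply_of_mem_Gamma0 χ hγ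
  have h2 : (starRingEnd ℂ) (χ ((γ 1 1 : ℤ) : ZMod N)) * χ ((γ 1 1 : ℤ) : ZMod N) = 1 := by
    rw [Complex.conj_mul', h]; simp
  simp only [petersson, Pi.smul_apply, smul_eq_mul, map_mul]
  linear_combination ((starRingEnd ℂ) (g τ) * f τ * (τ.im : ℂ) ^ k) * h2

theorem peterssonInner_eq_of_mem [NeZero N] {g : ℍ → ℂ} (hf : f ∈ cuspFormSpace N χ k)
    (hg : g ∈ cuspFormSpace N χ k) : peterssonInner N k f g = petPair k f g :=
  peterssonInner_eq_petPair N (isBoundedSlash_of_mem hf) (isBoundedSlash_of_mem hg)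
    fun _ hγ τ => petersson_smul_of_mem hf hg hγ τ

theorem integrableOn_petersson_of_mem [NeZero N] {g : ℍ → ℂ} (hf : f ∈ cuspFormSpace N χ k)
    (hg : g ∈ cuspFormSpace N χ k) : IntegrableOn (petersson k g f) (fundDomain N) :=
  ((isBoundedSlash_of_mem hf).isBoundedModular (isBoundedSlash_of_mem hg)).integrableOn
    (volume_cosetDomain_lt_top (neg_one_mem_Gamma0 N))

/-- Conjugation by `(ℓ, 0; 0, 1)` moves `Γ₀(M)` into `Γ₀(N)` if `ℓ N ∣ M`. -/
theorem exists_diagGL_mul_eq {M ℓ : ℕ} [NeZero ℓ] (h : N * ℓ ∣ M) {γ : SL(2, ℤ)}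
    (hγ : γ ∈ Gamma0 M) : ∃ δ ∈ Gamma0 N, δ 1 1 = γ 1 1 ∧ δ 0 0 = γ 0 0 ∧
      realGL (diagGL ℓ) * (Matrix.SpecialLinearGroup.mapGL ℝ γ) =
        (Matrix.SpecialLinearGroup.mapGL ℝ δ : GL (Fin 2) ℝ) * realGL (diagGL ℓ) := by
  have h1 : (M : ℤ) ∣ γ 1 0 := (ZMod.intCast_zmod_eq_zero_iff_dvd _ _).1 hγ
  have h2 : ((N * ℓ : ℕ) : ℤ) ∣ γ 1 0 := (Int.natCast_dvd_natCast.2 h).trans h1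
  obtain ⟨c, hc⟩ := h2
  push_cast at hc
  have hdet := γ.det_coe
  rw [Matrix.det_fin_two] at hdet
  refine ⟨intSL (γ 0 0) (ℓ * γ 0 1) (N * c) (γ 1 1) ?_, ?_, rfl, rfl, ?_⟩
  · rw [hc] at hdet
    linear_combination hdet
  · rw [Gamma0_mem]
    simp
  · ext i j
    fin_cases i <;> fin_cases j <;>
      simp [Matrix.mul_apply, Fin.sum_univ_two, realGL, triGL_val, hc] <;> ring

theorem changeLevel_apply_of_mem {M : ℕ} (h : N ∣ M) (χ : DirichletCharacter ℂ N) {γ : SL(2, ℤ)}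
    (hγ : γ ∈ Gamma0 M) : DirichletCharacter.changeLevel h χ ((γ 1 1 : ℤ) : ZMod M) =
      χ ((γ 1 1 : ℤ) : ZMod N) :=
  DirichletCharacter.changeLevel_eq_cast_of_dvd' χ h (isCoprime_of_mem_Gamma0 hγ)

theorem slash_diagGL_slash {M ℓ : ℕ} [NeZero ℓ] (h : N * ℓ ∣ M) (hf : f ∈ cuspFormSpace N χ k)
    {γ : SL(2, ℤ)} (hγ : γ ∈ Gamma0 M) :
    (f ∣[k] realGL (diagGL ℓ)) ∣[k] γ =
      χ ((γ 1 1 : ℤ) : ZMod N) • (f ∣[k] realGL (diagGL ℓ)) := by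
  obtain ⟨δ, hδ, hδ1, -, hδ2⟩ := exists_diagGL_mul_eq h hγ
  change (f ∣[k] realGL (diagGL ℓ)) ∣[k] (Matrix.SpecialLinearGroup.mapGL ℝ γ : GL (Fin 2) ℝ) = _
  rw [← SlashAction.slash_mul, hδ2, SlashAction.slash_mul]
  have h1 : f ∣[k] (Matrix.SpecialLinearGroup.mapGL ℝ δ : GL (Fin 2) ℝ) = _ := hf.2 δ hδ
  rw [h1, hδ1, ModularForm.smul_slash, σ, if_pos (realGL_det_pos (diagGL_det_pos ℓ))]
  rfl

open ConjAct Pointwise in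
theorem translateV_mem {M ℓ : ℕ} [NeZero ℓ] (h : N * ℓ ∣ M) (hf : f ∈ cuspFormSpace N χ k) :
    translateV ℓ f ∈ cuspFormSpace M
      (DirichletCharacter.changeLevel (Dvd.dvd.trans (Nat.dvd_mul_right N ℓ) h) χ) k := by
  rw [translateV_eq_slash k]
  refine Submodule.smul_mem _ _ ⟨?_, fun γ hγ => ?_⟩
  · obtain ⟨⟨F, rfl⟩, hF⟩ := id hf
    -- F slashed by (ℓ, 0; 0, 1) is a cusp form for the conjugate of Γ₁(N), and this conjugate
    -- contains Γ₁(M).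
    have hle : (Gamma1 M).map (Matrix.SpecialLinearGroup.mapGL ℝ) ≤
        toConjAct (realGL (diagGL ℓ))⁻¹ • (Gamma1 N).map (Matrix.SpecialLinearGroup.mapGL ℝ) := by
      rintro _ ⟨γ, hγ, rfl⟩
      obtain ⟨δ, hδ, hδ1, hδ0, hδ2⟩ := exists_diagGL_mul_eq h (Gamma1_in_Gamma0 M hγ)
      have hγ' := (Gamma1_mem M γ).1 hγ
      have hcast : ∀ x : ℤ, (x : ZMod M) = 1 → (x : ZMod N) = 1 := fun x hx => by
        have := congrArg (ZMod.castHom (Dvd.dvd.trans (Nat.dvd_mul_right N ℓ) h) (ZMod N)) hx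
        simpa only [map_intCast, map_one] using this
      rw [map_inv, Subgroup.mem_inv_pointwise_smul_iff, toConjAct_smul]
      refine ⟨δ, (Gamma1_mem N δ).2 ⟨?_, ?_, hδ⟩, ?_⟩
      · rw [hδ0]; exact hcast _ hγ'.1
      · rw [hδ1]; exact hcast _ hγ'.2.1
      · rw [hδ2]; group
    let G := CuspForm.translate F (realGL (diagGL ℓ))
    exact ⟨{ toFun := G
             slash_action_eq' := fun γ hγ => G.slash_action_eq' γ (hle hγ)
             holo' := G.holo'
             zero_at_cusps' := fun hc => G.zero_at_cusps' (hc.mono hle) }, rfl⟩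
  · rw [slash_diagGL_slash h hf hγ, changeLevel_apply_of_mem _ _ hγ]

end CuspForms

/-! ### Coset representatives for T(1, p) -/

section Hecke

open PrimitiveTranslates Matrix.SpecialLinearGroup

variable {N : ℕ} {χ : DirichletCharacter ℂ N} {k : ℤ} {f : ℍ → ℂ}

theorem apply_mul_apply_of_mem_Gamma0 (χ : DirichletCharacter ℂ N) {γ : SL(2, ℤ)}
    (h : γ ∈ Gamma0 N) : χ ((γ 0 0 : ℤ) : ZMod N) * χ ((γ 1 1 : ℤ) : ZMod N) = 1 := by
  have h1 : ((γ 1 0 : ℤ) : ZMod N) = 0 := h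
  have h2 := congrArg (Int.cast : ℤ → ZMod N) γ.det_coe
  rw [Matrix.det_fin_two] at h2
  push_cast at h2
  rw [h1, mul_zero, sub_zero] at h2
  rw [← map_mul, h2, map_one]

theorem slash_mapGL_of_mem (hf : f ∈ cuspFormSpace N χ k) {γ : SL(2, ℤ)} (hγ : γ ∈ Gamma0 N) :
    f ∣[k] realGL (mapGL ℚ γ) = χ ((γ 1 1 : ℤ) : ZMod N) • f := by
  rw [realGL_mapGL]
  exact hf.2 γ hγ

/-- The summand of the Hecke operator for a representative with upper triangular form. -/
theorem heckeSummand_eq (hf : f ∈ cuspFormSpace N χ k) {γ : SL(2, ℤ)} (hγ : γ ∈ Gamma0 N)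
    {a b d : ℕ} (h : (a : ℚ) * d ≠ 0) :
    χ ((((mapGL ℚ γ * triGL a b d h : GL (Fin 2) ℚ) 0 0 : ℚ).num : ℤ) : ZMod N) •
      (f ∣[k] realGL (mapGL ℚ γ * triGL a b d h)) =
    χ (a : ZMod N) • (f ∣[k] realGL (triGL a b d h)) := by
  have h1 : (mapGL ℚ γ * triGL a b d h : GL (Fin 2) ℚ) 0 0 = ((γ 0 0 * a : ℤ) : ℚ) := by
    simp [Matrix.mul_apply, Fin.sum_univ_two, triGL_val]
  have hpos : 0 < (triGL (a : ℚ) b d h).det.val := by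
    rw [triGL_det]
    exact lt_of_le_of_ne (by positivity) h.symm
  rw [h1, Rat.num_intCast, realGL, map_mul, SlashAction.slash_mul, slash_mapGL_of_mem hf hγ,
    ModularForm.smul_slash, σ, if_pos (realGL_det_pos hpos)]
  -- The factor χ(γ₀₀) from the upper left entry cancels χ(γ₁₁) from f|γ, so the summand does not
  -- depend on the representative of the coset.
  have h2 := apply_mul_apply_of_mem_Gamma0 χ hγ
  change χ _ • χ _ • _ = _
  rw [smul_smul]
  congr 1
  push_cast
  rw [map_mul, mul_right_comm, h2, one_mul]

theorem mk_eq_iff {x y : GL (Fin 2) ℚ} :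
    (Quotient.mk (QuotientGroup.rightRel (Gamma0Rat N)) x =
      Quotient.mk (QuotientGroup.rightRel (Gamma0Rat N)) y) ↔ y * x⁻¹ ∈ Gamma0Rat N := by
  rw [Quotient.eq, QuotientGroup.rightRel_apply]

theorem mk_mapGL_mul {γ : SL(2, ℤ)} (hγ : γ ∈ Gamma0 N) (x : GL (Fin 2) ℚ) :
    Quotient.mk (QuotientGroup.rightRel (Gamma0Rat N)) (mapGL ℚ γ * x) =
      Quotient.mk (QuotientGroup.rightRel (Gamma0Rat N)) x := by
  rw [mk_eq_iff, mul_inv_rev, mul_inv_cancel_left]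
  exact inv_mem ⟨γ, hγ, rfl⟩

theorem exists_out_eq (x : GL (Fin 2) ℚ) : ∃ γ ∈ Gamma0 N,
    (Quotient.mk (QuotientGroup.rightRel (Gamma0Rat N)) x).out = mapGL ℚ γ * x := by
  have h := mk_eq_iff.1 (Quotient.out_eq
    (Quotient.mk (QuotientGroup.rightRel (Gamma0Rat N)) x)).symm
  obtain ⟨γ, hγ, h⟩ := h
  exact ⟨γ, hγ, by rw [h]; group⟩

variable {p : ℕ} [NeZero p]

/-- The representative `(1, j; 0, p)`. -/
noncomputable abbrev lowGL (p j : ℕ) [NeZero p] : GL (Fin 2) ℚ :=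
  triGL (1 : ℕ) j p (by simp [NeZero.ne p])

/-- The representative `(p, 0; 0, 1)`, with all entries natural numbers. -/
noncomputable abbrev highGL (p : ℕ) [NeZero p] : GL (Fin 2) ℚ :=
  triGL p (0 : ℕ) (1 : ℕ) (by simp [NeZero.ne p])

theorem highGL_eq (p : ℕ) [NeZero p] : highGL p = diagGL p := by
  simp [highGL, diagGL]

theorem heckeDoubleCoset_eq (N p : ℕ) [NeZero p] : heckeDoubleCoset N 1 p =
    {g | ∃ γ₁ ∈ Gamma0 N, ∃ γ₂ ∈ Gamma0 N, g = mapGL ℚ γ₁ * lowGL p 0 * mapGL ℚ γ₂} := by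
  ext g
  constructor
  · rintro ⟨_, ⟨γ₁, h₁, rfl⟩, _, ⟨γ₂, h₂, rfl⟩, h⟩
    refine ⟨γ₁, h₁, γ₂, h₂, Units.ext ?_⟩
    rw [h]
    simp [triGL_val]
  · rintro ⟨γ₁, h₁, γ₂, h₂, rfl⟩
    refine ⟨_, ⟨γ₁, h₁, rfl⟩, _, ⟨γ₂, h₂, rfl⟩, ?_⟩
    simp [triGL_val]

/-- With γ = (a, b; c, d), the matrix (1, 0; 0, p) γ (1, j; 0, p)⁻¹ is integral exactly when p ∣ b -
aj, which can be solved for j because a is invertible modulo p. -/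
theorem lowGL_zero_mul_of_not_dvd (hp : p.Prime) {γ : SL(2, ℤ)} (hγ : γ ∈ Gamma0 N)
    (ha : ¬ (p : ℤ) ∣ γ 0 0) :
    ∃ j < p, ∃ δ ∈ Gamma0 N, lowGL p 0 * mapGL ℚ γ = mapGL ℚ δ * lowGL p j := by
  have : Fact p.Prime := ⟨hp⟩
  have ha' : ((γ 0 0 : ℤ) : ZMod p) ≠ 0 := fun h => ha ((ZMod.intCast_zmod_eq_zero_iff_dvd _ _).1 h)
  set j := (((γ 0 1 : ℤ) : ZMod p) * ((γ 0 0 : ℤ) : ZMod p)⁻¹).val with hj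
  have hdvd : (p : ℤ) ∣ γ 0 1 - γ 0 0 * j := by
    rw [← ZMod.intCast_zmod_eq_zero_iff_dvd]
    push_cast
    rw [hj, ZMod.natCast_val, ZMod.cast_id]
    field_simp
    simp
  obtain ⟨e, he⟩ := hdvd
  have hdet := γ.det_coe
  rw [Matrix.det_fin_two] at hdet
  refine ⟨j, ZMod.val_lt _, intSL (γ 0 0) e (p * γ 1 0) (γ 1 1 - γ 1 0 * j) ?_, ?_, ?_⟩
  · linear_combination hdet + γ 1 0 * he
  · have h1 : ((γ 1 0 : ℤ) : ZMod N) = 0 := hγ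
    rw [Gamma0_mem]
    simp [h1]
  · have heQ : ((γ 0 1 : ℤ) : ℚ) - (γ 0 0 : ℤ) * j = p * e := by exact_mod_cast he
    ext i l
    fin_cases i <;> fin_cases l <;>
      simp [Matrix.mul_apply, Fin.sum_univ_two, triGL_val]
    · linear_combination heQ
    · ring

/-- In the remaining case (1, 0; 0, p) γ (p, 0; 0, 1)⁻¹ is integral, its upper left entry being a/p.
-/
theorem lowGL_zero_mul_of_dvd {γ : SL(2, ℤ)} (hγ : γ ∈ Gamma0 N)
    (ha : (p : ℤ) ∣ γ 0 0) :
    ∃ δ ∈ Gamma0 N, lowGL p 0 * mapGL ℚ γ = mapGL ℚ δ * highGL p := by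
  obtain ⟨e, he⟩ := ha
  have hdet := γ.det_coe
  rw [Matrix.det_fin_two] at hdet
  refine ⟨intSL e (γ 0 1) (γ 1 0) (p * γ 1 1) ?_, ?_, ?_⟩
  · rw [he] at hdet
    linear_combination hdet
  · exact hγ
  · ext i l
    fin_cases i <;> fin_cases l <;>
      simp [Matrix.mul_apply, Fin.sum_univ_two, triGL_val, he] <;> ring

/-- Integral matrices that move `(1, 0; 0, p)` to `(p, 0; 0, 1)`. -/
theorem exists_highGL_mul_eq (h : p.Coprime N) : ∃ γ ∈ Gamma0 N, ∃ γ' ∈ Gamma0 N,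
    γ 1 1 = 1 ∧ γ' 1 1 = p ∧ highGL p * mapGL ℚ γ' = mapGL ℚ γ * lowGL p 0 := by
  -- From xp + yN = 1 both (px, -y; N, 1) and (x, -y; N, p) have determinant one.
  obtain ⟨x, y, hxy⟩ := Nat.isCoprime_iff_coprime.2 h
  refine ⟨intSL (p * x) (-y) N 1 (by linear_combination hxy), by simp [Gamma0_mem],
    intSL x (-y) N p (by linear_combination hxy), by simp [Gamma0_mem], rfl, rfl, ?_⟩
  ext i l
  fin_cases i <;> fin_cases l <;>
      simp [Matrix.mul_apply, Fin.sum_univ_two, triGL_val] <;> ring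

theorem mk_lowGL_injOn (hp : p.Prime) : Set.InjOn
    (fun j : ℕ => Quotient.mk (QuotientGroup.rightRel (Gamma0Rat N)) (lowGL p j)) (Set.Iio p) := by
  intro i hi j hj h
  obtain ⟨γ, hγ, h⟩ := mk_eq_iff.1 h
  have h1 : lowGL p j = mapGL ℚ γ * lowGL p i := by rw [h]; group
  have hp0 : (p : ℚ) ≠ 0 := by exact_mod_cast hp.ne_zero
  have h00 := congrArg (fun g : GL (Fin 2) ℚ => g 0 0) h1
  have h01 := congrArg (fun g : GL (Fin 2) ℚ => g 0 1) h1
  simp [Matrix.mul_apply, Fin.sum_univ_two, triGL_val] at h00 h01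
  rw [← h00, one_mul] at h01
  have h2 : (j : ℤ) = i + γ 0 1 * p := by exact_mod_cast h01
  have h3 : (p : ℤ) ∣ j - i := ⟨γ 0 1, by rw [h2]; ring⟩
  have h4 := (Nat.modEq_iff_dvd.2 h3)
  rwa [Nat.ModEq, Nat.mod_eq_of_lt hi, Nat.mod_eq_of_lt hj] at h4

theorem mk_highGL_ne (hp : p.Prime) (j : ℕ) :
    Quotient.mk (QuotientGroup.rightRel (Gamma0Rat N)) (lowGL p j) ≠
      Quotient.mk (QuotientGroup.rightRel (Gamma0Rat N)) (highGL p) := by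
  intro h
  obtain ⟨γ, hγ, h⟩ := mk_eq_iff.1 h.symm
  have h1 : lowGL p j = mapGL ℚ γ * highGL p := by rw [h]; group
  have h00 := congrArg (fun g : GL (Fin 2) ℚ => g 0 0) h1
  simp [Matrix.mul_apply, Fin.sum_univ_two, triGL_val] at h00
  have h2 : (1 : ℤ) = γ 0 0 * p := by exact_mod_cast h00
  have h3 : (p : ℤ) ∣ 1 := ⟨γ 0 0, h2.trans (mul_comm _ _)⟩
  exact hp.one_lt.ne' (by exact_mod_cast Int.eq_one_of_dvd_one (by positivity) h3)

theorem lowGL_mem_image (p j : ℕ) [NeZero p] :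
    Quotient.mk (QuotientGroup.rightRel (Gamma0Rat N)) (lowGL p j) ∈
      (Quotient.mk (QuotientGroup.rightRel (Gamma0Rat N))) '' heckeDoubleCoset N 1 p := by
  refine ⟨_, ?_, rfl⟩
  rw [heckeDoubleCoset_eq]
  refine ⟨1, one_mem _, intSL 1 j 0 1 (by ring), by simp [Gamma0_mem], ?_⟩
  ext i l
  fin_cases i <;> fin_cases l <;>
    simp [Matrix.mul_apply, Fin.sum_univ_two, triGL_val]

theorem image_heckeDoubleCoset_of_dvd (hp : p.Prime) (h : p ∣ N) :
    (Quotient.mk (QuotientGroup.rightRel (Gamma0Rat N))) '' heckeDoubleCoset N 1 p =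
      (fun j : ℕ => Quotient.mk (QuotientGroup.rightRel (Gamma0Rat N)) (lowGL p j)) ''
        Set.Iio p := by
  refine Set.Subset.antisymm ?_ ?_
  · rintro _ ⟨g, hg, rfl⟩
    rw [heckeDoubleCoset_eq] at hg
    obtain ⟨γ₁, h₁, γ₂, h₂, rfl⟩ := hg
    -- Since p ∣ N divides the lower left entry, it cannot divide the upper left one as well: the
    -- determinant is one. So (p, 0; 0, 1) does not occur.
    have ha : ¬ (p : ℤ) ∣ γ₂ 0 0 := by
      intro ha
      have hc : (p : ℤ) ∣ γ₂ 1 0 := (Int.natCast_dvd_natCast.2 h).trans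
        ((ZMod.intCast_zmod_eq_zero_iff_dvd _ _).1 h₂)
      have hdet := γ₂.det_coe
      rw [Matrix.det_fin_two] at hdet
      have h3 : (p : ℤ) ∣ 1 := hdet ▸ dvd_sub (ha.mul_right _) (hc.mul_left _)
      exact hp.one_lt.ne' (by exact_mod_cast Int.eq_one_of_dvd_one (by positivity) h3)
    obtain ⟨j, hj, δ, hδ, h⟩ := lowGL_zero_mul_of_not_dvd hp h₂ ha
    refine ⟨j, hj, ?_⟩
    rw [mul_assoc, h, mk_mapGL_mul h₁, mk_mapGL_mul hδ]
  · rintro _ ⟨j, -, rfl⟩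
    exact lowGL_mem_image p j

theorem image_heckeDoubleCoset_of_not_dvd (hp : p.Prime) (h : ¬ p ∣ N) :
    (Quotient.mk (QuotientGroup.rightRel (Gamma0Rat N))) '' heckeDoubleCoset N 1 p =
      insert (Quotient.mk (QuotientGroup.rightRel (Gamma0Rat N)) (highGL p))
      ((fun j : ℕ => Quotient.mk (QuotientGroup.rightRel (Gamma0Rat N)) (lowGL p j)) ''
        Set.Iio p) := by
  refine Set.Subset.antisymm ?_ ?_
  · rintro _ ⟨g, hg, rfl⟩
    rw [heckeDoubleCoset_eq] at hg
    obtain ⟨γ₁, h₁, γ₂, h₂, rfl⟩ := hg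
    by_cases ha : (p : ℤ) ∣ γ₂ 0 0
    · obtain ⟨δ, hδ, h⟩ := lowGL_zero_mul_of_dvd h₂ ha
      left
      rw [mul_assoc, h, mk_mapGL_mul h₁, mk_mapGL_mul hδ]
    · obtain ⟨j, hj, δ, hδ, h⟩ := lowGL_zero_mul_of_not_dvd hp h₂ ha
      refine Or.inr ⟨j, hj, ?_⟩
      rw [mul_assoc, h, mk_mapGL_mul h₁, mk_mapGL_mul hδ]
  · refine Set.insert_subset ?_ ?_
    · refine ⟨_, ?_, rfl⟩
      rw [heckeDoubleCoset_eq]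
      obtain ⟨γ, hγ, γ', hγ', -, -, h⟩ := exists_highGL_mul_eq
        ((Nat.Prime.coprime_iff_not_dvd hp).2 h)
      exact ⟨γ, hγ, γ'⁻¹, inv_mem hγ', by rw [← h, map_inv, mul_inv_cancel_right]⟩
    · rintro _ ⟨j, -, rfl⟩
      exact lowGL_mem_image p j

/-- The Hecke operator `T(1, p)` in terms of representatives. -/
theorem heckeT_eq_sum (hf : f ∈ cuspFormSpace N χ k) (hp : p.Prime) :
    heckeT N χ k 1 p f = ∑ j ∈ Finset.range p, f ∣[k] realGL (lowGL p j) +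
      χ (p : ZMod N) • (f ∣[k] realGL (diagGL p)) := by
  have hlow : ∀ j, χ ((((Quotient.mk (QuotientGroup.rightRel (Gamma0Rat N))
      (lowGL p j)).out 0 0 : ℚ).num : ℤ) : ZMod N) • (f ∣[k] realGL
        (Quotient.mk (QuotientGroup.rightRel (Gamma0Rat N)) (lowGL p j)).out) =
      f ∣[k] realGL (lowGL p j) := by
    intro j
    obtain ⟨γ, hγ, h⟩ := exists_out_eq (N := N) (lowGL p j)
    rw [h, heckeSummand_eq hf hγ, Nat.cast_one, map_one, one_smul]
  have hsum : ∑ᶠ q ∈ (fun j : ℕ => Quotient.mk (QuotientGroup.rightRel (Gamma0Rat N))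
      (lowGL p j)) '' Set.Iio p, χ (((q.out 0 0 : ℚ).num : ℤ) : ZMod N) • (f ∣[k] realGL q.out) =
      ∑ j ∈ Finset.range p, f ∣[k] realGL (lowGL p j) := by
    rw [finsum_mem_image (mk_lowGL_injOn hp), ← Finset.coe_range, finsum_mem_coe_finset]
    exact Finset.sum_congr rfl fun j _ => hlow j
  change (∑ᶠ q ∈ (Quotient.mk (QuotientGroup.rightRel (Gamma0Rat N))) '' heckeDoubleCoset N 1 p,
    χ (((q.out 0 0 : ℚ).num : ℤ) : ZMod N) • (f ∣[k] realGL q.out)) = _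
  by_cases h : p ∣ N
  · have hχ : χ (p : ZMod N) = 0 := by
      refine MulChar.map_nonunit _ fun hu => ?_
      have := (ZMod.isUnit_iff_coprime p N).1 hu
      exact (Nat.Prime.coprime_iff_not_dvd hp).1 this h
    rw [image_heckeDoubleCoset_of_dvd hp h, hsum, hχ, zero_smul, add_zero]
  · rw [image_heckeDoubleCoset_of_not_dvd hp h, finsum_mem_insert _ ?_ (Set.toFinite _), hsum,
      add_comm]
    · congr 1
      obtain ⟨γ, hγ, h⟩ := exists_out_eq (N := N) (highGL p)
      rw [h, heckeSummand_eq hf hγ, ← highGL_eq]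
    · rintro ⟨j, -, hj⟩
      exact mk_highGL_ne hp j hj

end Hecke

/-! ### Periods of a cusp form and independence of its translates -/

section QExpansion

open PrimitiveTranslates

variable {N : ℕ} {χ : DirichletCharacter ℂ N} {k : ℤ} {f : ℍ → ℂ}

theorem one_mem_strictPeriods_Gamma1 (N : ℕ) : (1 : ℝ) ∈
    ((Gamma1 N).map (Matrix.SpecialLinearGroup.mapGL ℝ)).strictPeriods := by
  rw [strictPeriods_Gamma1 N]
  exact AddSubgroup.mem_zmultiples 1

theorem qParam_vadd (x : ℝ) (τ : ℍ) : Function.Periodic.qParam 1 ((x +ᵥ τ : ℍ) : ℂ) =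
    Complex.exp (2 * Real.pi * Complex.I * x) * Function.Periodic.qParam 1 τ := by
  simp only [Function.Periodic.qParam, coe_vadd, ← Complex.exp_add]
  congr 1
  push_cast
  ring

theorem hasSum_of_mem [NeZero N] (hf : f ∈ cuspFormSpace N χ k) (τ : ℍ) :
    HasSum (fun m => (qExpansion 1 f).coeff m * Function.Periodic.qParam 1 τ ^ m) (f τ) := by
  obtain ⟨⟨F, rfl⟩, -⟩ := hf
  exact ModularForm.hasSum_qExpansion F one_pos (one_mem_strictPeriods_Gamma1 N) τ

theorem apply_int_vadd [NeZero N] (hf : f ∈ cuspFormSpace N χ k) (n : ℤ) (τ : ℍ) :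
    f ((n : ℝ) +ᵥ τ) = f τ := by
  have h1 := hasSum_of_mem hf ((n : ℝ) +ᵥ τ)
  have h2 : Complex.exp (2 * Real.pi * Complex.I * (n : ℝ)) = 1 :=
    Complex.exp_eq_one_iff.2 ⟨n, by push_cast; ring⟩
  rw [qParam_vadd, h2, one_mul] at h1
  exact h1.unique (hasSum_of_mem hf τ)

/-- A cusp form whose first coefficient does not vanish has only integral periods. -/
theorem exists_int_of_periodic [NeZero N] (hf : f ∈ cuspFormSpace N χ k)
    (h1 : (qExpansion 1 f).coeff 1 ≠ 0) {x : ℝ} (hx : ∀ τ : ℍ, f (x +ᵥ τ) = f τ) :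
    ∃ n : ℤ, x = n := by
  set ζ := Complex.exp (2 * Real.pi * Complex.I * x) with hζ
  have h2 : ∀ τ : ℍ, HasSum (fun m => ((qExpansion 1 f).coeff m * ζ ^ m) •
      Function.Periodic.qParam 1 τ ^ m) (f τ) := by
    intro τ
    have := hasSum_of_mem hf (x +ᵥ τ)
    rw [hx] at this
    refine this.congr_fun fun m => ?_
    rw [qParam_vadd, ← hζ, mul_pow, smul_eq_mul, mul_assoc]
  -- A period x gives f a second q-expansion, with coefficients a_m ζ^m where ζ = exp(2πix).
  -- Uniqueness at m = 1 forces ζ = 1.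
  have h3 : (qExpansion 1 f).coeff 1 * ζ ^ 1 = (qExpansion 1 f).coeff 1 := by
    obtain ⟨⟨F, rfl⟩, -⟩ := hf
    exact ModularFormClass.qExpansion_coeff_unique (Γ := (Gamma1 N).map
      (Matrix.SpecialLinearGroup.mapGL ℝ)) (k := k) one_pos (one_mem_strictPeriods_Gamma1 N) h2 1
  have h4 : ζ = 1 := by
    rw [pow_one] at h3
    exact mul_left_cancel₀ h1 (by rw [h3, mul_one])
  obtain ⟨n, hn⟩ := Complex.exp_eq_one_iff.1 h4
  refine ⟨n, ?_⟩
  have h5 : (x : ℂ) = n := by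
    have : (2 * Real.pi * Complex.I : ℂ) ≠ 0 := Complex.two_pi_I_ne_zero
    refine mul_left_cancel₀ this ?_
    rw [hn]; ring
  exact_mod_cast h5

theorem translateV_vadd (ℓ : ℕ) [NeZero ℓ] (u : ℍ → ℂ) (x : ℝ) (τ : ℍ) :
    translateV ℓ u (x +ᵥ τ) = u ((ℓ * x : ℝ) +ᵥ ofComplex ((ℓ : ℂ) * τ)) := by
  have h : 0 < ((ℓ : ℂ) * τ).im := by
    have := τ.im_pos
    have hℓ : (0 : ℝ) < ℓ := by exact_mod_cast Nat.pos_of_ne_zero (NeZero.ne ℓ)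
    simp [this, hℓ]
  rw [translateV]
  congr 1
  rw [ofComplex_apply_of_im_pos h]
  ext
  rw [coe_vadd, coe_vadd, ofComplex_apply_of_im_pos]
  · push_cast
    ring
  · simpa [mul_add] using h

theorem ofComplex_surj (ℓ : ℕ) [NeZero ℓ] (τ : ℍ) :
    ∃ σ : ℍ, ofComplex ((ℓ : ℂ) * σ) = τ := by
  have hℓ : (0 : ℝ) < ℓ := by exact_mod_cast Nat.pos_of_ne_zero (NeZero.ne ℓ)
  refine ⟨⟨(ℓ : ℂ)⁻¹ * τ, ?_⟩, ?_⟩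
  · have : ((ℓ : ℂ)⁻¹ * τ).im = (ℓ : ℝ)⁻¹ * τ.im := by
      rw [← Complex.ofReal_natCast, ← Complex.ofReal_inv, Complex.im_ofReal_mul, coe_im]
    rw [this]
    exact mul_pos (inv_pos.2 hℓ) τ.im_pos
  · have : (ℓ : ℂ) * ((ℓ : ℂ)⁻¹ * τ) = τ := mul_inv_cancel_left₀ (by exact_mod_cast hℓ.ne') _
    change ofComplex ((ℓ : ℂ) * ((ℓ : ℂ)⁻¹ * τ)) = τ
    rw [this, ofComplex_apply]

theorem ne_zero_of_coeff_ne_zero (h1 : (qExpansion 1 f).coeff 1 ≠ 0) : f ≠ 0 := by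
  rintro rfl
  rw [qExpansion_zero] at h1
  simp at h1

/-- Let i be the least index with nonzero coefficient in a relation. Shifting by x = p^(-(i+1))
fixes every f|V_{p^j} with j > i, hence also f|V_{p^i}. Then p^i x = 1/p is a period of f, which is
not an integer. -/
theorem linearIndependent_translateV [NeZero N] (hf : f ∈ cuspFormSpace N χ k)
    (h1 : (qExpansion 1 f).coeff 1 ≠ 0) {p : ℕ} (hp : p.Prime) :
    LinearIndependent ℂ fun j : ℕ => translateV (p ^ j) f := by
  have : NeZero p := ⟨hp.ne_zero⟩
  rw [linearIndependent_iff']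
  intro s c hc
  by_contra! hne
  obtain ⟨i₀, hi₀, hci₀⟩ := hne
  have hex : ∃ j, j ∈ s ∧ c j ≠ 0 := ⟨i₀, hi₀, hci₀⟩
  classical
  let i := Nat.find hex
  obtain ⟨his, hci⟩ : i ∈ s ∧ c i ≠ 0 := Nat.find_spec hex
  have hmin : ∀ j ∈ s, j < i → c j = 0 := fun j hj hji => by
    by_contra h
    exact Nat.find_min hex hji ⟨hj, h⟩
  have hp0 : (p : ℝ) ≠ 0 := by exact_mod_cast hp.ne_zero
  set x : ℝ := (p : ℝ)⁻¹ ^ (i + 1) with hx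
  have hper : ∀ j ∈ s.erase i, ∀ τ : ℍ,
      (c j • translateV (p ^ j) f) (x +ᵥ τ) = (c j • translateV (p ^ j) f) τ := by
    intro j hj τ
    rw [Finset.mem_erase] at hj
    rcases lt_or_gt_of_ne hj.1 with h | h
    · rw [hmin j hj.2 h]; simp
    · rw [Pi.smul_apply, Pi.smul_apply, translateV_vadd]
      obtain ⟨e, rfl⟩ := Nat.exists_eq_add_of_lt h
      have : ((p ^ (i + e + 1) : ℕ) : ℝ) * x = ((p ^ e : ℤ) : ℝ) := by
        rw [hx]
        push_cast
        rw [show i + e + 1 = e + (i + 1) by ring, pow_add, mul_assoc, ← mul_pow,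
          mul_inv_cancel₀ hp0, one_pow, mul_one]
      rw [this, apply_int_vadd hf]
      rfl
  have hsplit : ∀ τ : ℍ, (c i • translateV (p ^ i) f) τ =
      - ∑ j ∈ s.erase i, (c j • translateV (p ^ j) f) τ := by
    intro τ
    rw [eq_neg_iff_add_eq_zero, Finset.add_sum_erase s (fun j => (c j • translateV (p ^ j) f) τ) his]
    have := congrFun hc τ
    simpa using this
  have hper' : ∀ τ : ℍ, f ((p ^ i * x : ℝ) +ᵥ τ) = f τ := by
    intro τ
    obtain ⟨σ, rfl⟩ := ofComplex_surj (p ^ i) τ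
    have h2 : (c i • translateV (p ^ i) f) (x +ᵥ σ) = (c i • translateV (p ^ i) f) σ := by
      rw [hsplit, hsplit]
      exact congrArg _ (Finset.sum_congr rfl fun j hj => hper j hj σ)
    rw [Pi.smul_apply, Pi.smul_apply, translateV_vadd, smul_right_inj hci] at h2
    push_cast at h2 ⊢
    rw [h2, translateV]
    push_cast
    rfl
  obtain ⟨n, hn⟩ := exists_int_of_periodic hf h1 hper'
  have h3 : (p : ℝ) ^ i * x = (p : ℝ)⁻¹ := by
    rw [hx, pow_succ, ← mul_assoc, ← mul_pow, mul_inv_cancel₀ hp0, one_pow, one_mul]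
  rw [h3] at hn
  have h4 : (1 : ℤ) = n * p := by
    have : (1 : ℝ) = n * p := by rw [← hn, inv_mul_cancel₀ hp0]
    exact_mod_cast this
  have h5 : (p : ℤ) ∣ 1 := ⟨n, by rw [h4]; ring⟩
  exact hp.one_lt.ne' (by exact_mod_cast Int.eq_one_of_dvd_one (by positivity) h5)

end QExpansion

/-! ### Relations between Petersson products of translates -/

section Relations

open PrimitiveTranslates
open scoped ComplexConjugate

variable {N : ℕ} {χ : DirichletCharacter ℂ N} {k : ℤ} {f u v : ℍ → ℂ} {p : ℕ} [NeZero p]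

theorem conj_natCast_zpow (p : ℕ) (k : ℤ) : conj ((p : ℂ) ^ k) = (p : ℂ) ^ k := by
  rw [map_zpow₀, Complex.conj_natCast]

theorem petPair_translateV (hu : IsBoundedSlash k u) (hv : IsBoundedSlash k v) :
    petPair k (translateV p u) (translateV p v) = ((p : ℂ) ^ k)⁻¹ * petPair k u v := by
  have hp : (p : ℂ) ≠ 0 := by exact_mod_cast NeZero.ne p
  have hu' := hu.slash (diagGL_det_pos p)
  have hv' := hv.slash (diagGL_det_pos p)
  rw [translateV_eq_slash k p u, translateV_eq_slash k p v, petPair_smul_left hu' (hv'.smul _),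
    petPair_smul_right hu' hv', petPair_slash hu hv (diagGL_det_pos p), diagGL_det,
    conj_natCast_zpow, ← mul_assoc, ← mul_assoc]
  congr 1
  rw [Rat.cast_natCast, ← zpow_add₀ hp, ← zpow_add₀ hp, ← zpow_neg]
  congr 1
  ring

theorem lowGL_det (p j : ℕ) [NeZero p] : (lowGL p j).det.val = p := by
  rw [lowGL, triGL_det]; simp

theorem lowGL_det_pos (p j : ℕ) [NeZero p] : 0 < (lowGL p j).det.val := by
  rw [lowGL_det]
  exact_mod_cast Nat.pos_of_ne_zero (NeZero.ne p)

/-- V_p undoes the division by p in (τ + j)/p, leaving a shift by j and the factor p^(k-1) p^(-k).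
-/
theorem translateV_slash_lowGL (k : ℤ) (u : ℍ → ℂ) (j : ℕ)
    (hu : ∀ τ : ℍ, u ((j : ℝ) +ᵥ τ) = u τ) :
    translateV p u ∣[k] realGL (lowGL p j) = (p : ℂ)⁻¹ • u := by
  have hp : (p : ℂ) ≠ 0 := by exact_mod_cast NeZero.ne p
  have hp' : (0 : ℚ) < ((1 : ℕ) : ℚ) * p := by
    rw [Nat.cast_one, one_mul]; exact_mod_cast Nat.pos_of_ne_zero (NeZero.ne p)
  have hpR : (0 : ℝ) < p := by exact_mod_cast Nat.pos_of_ne_zero (NeZero.ne p)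
  ext τ
  rw [slash_triGL k _ hp', Pi.smul_apply, smul_eq_mul, ← hu τ]
  have h1 : (((1 : ℕ) : ℚ) : ℂ) = 1 := by simp
  have h2 : ((p : ℚ) : ℂ) = p := by simp
  have h3 : ((j : ℚ) : ℂ) = j := by simp
  rw [h1, h2, h3, one_mul, one_mul, ← zpow_add₀ hp]
  have hpow : k - 1 + -k = -1 := by ring
  rw [hpow, zpow_neg_one, translateV]
  congr 2
  have him : 0 < (((τ : ℂ) + j) / p).im := by
    have h4 : ((τ : ℂ) + j) / p = ((p⁻¹ : ℝ) : ℂ) * (τ + j) := by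
      push_cast; field_simp
    rw [h4, Complex.im_ofReal_mul]
    refine mul_pos (inv_pos.2 hpR) ?_
    simpa using τ.im_pos
  rw [ofComplex_apply_of_im_pos him]
  have h5 : (p : ℂ) * (((τ : ℂ) + j) / p) = (((j : ℝ) +ᵥ τ : ℍ) : ℂ) := by
    rw [coe_vadd]
    push_cast
    field_simp
    ring
  change ofComplex ((p : ℂ) * (((τ : ℂ) + j) / p)) = _
  rw [h5, ofComplex_apply]

theorem translateV_nat_vadd [NeZero N] (hf : f ∈ cuspFormSpace N χ k) (ℓ : ℕ) [NeZero ℓ] (j : ℕ)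
    (τ : ℍ) : translateV ℓ f ((j : ℝ) +ᵥ τ) = translateV ℓ f τ := by
  rw [translateV_vadd]
  have : (ℓ * j : ℝ) = ((ℓ * j : ℤ) : ℝ) := by push_cast; rfl
  rw [this, apply_int_vadd hf]
  rfl

theorem translateV_pow_succ (p n : ℕ) [NeZero p] (u : ℍ → ℂ) :
    translateV (p ^ (n + 1)) u = translateV p (translateV (p ^ n) u) := by
  rw [translateV_mul, pow_succ']

/-- The recursion satisfied by the Petersson products of an eigenform with its translates. -/
theorem petPair_translateV_succ [NeZero N] (hf : f ∈ cuspFormSpace N χ k) {lam : ℂ}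
    (hlam : ∑ j ∈ Finset.range p, f ∣[k] realGL (lowGL p j) +
      χ (p : ZMod N) • (f ∣[k] realGL (diagGL p)) = lam • f) (n : ℕ) :
    petPair k (translateV (p ^ (n + 1)) f) f = ((p : ℂ) ^ k)⁻¹ *
      (conj lam * petPair k (translateV (p ^ n) f) f - conj (χ (p : ZMod N)) * (p : ℂ) ^ (k - 1) *
        petPair k (translateV (p ^ n) f) (translateV p f)) := by
  have hp : (p : ℂ) ≠ 0 := by exact_mod_cast NeZero.ne p
  have hb := isBoundedSlash_of_mem hf
  have hV : ∀ n, IsBoundedSlash k (translateV (p ^ n) f) := fun n => hb.translateV _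
  -- Up to the factor p, f|V_{p^n} is itself f|V_{p^(n+1)} slashed by (1, j; 0, p). The matrix thus
  -- appears on both sides and is removed at the cost of det^(k-2) = p^(k-2).
  have h1 : ∀ j, petPair k (translateV (p ^ n) f) (f ∣[k] realGL (lowGL p j)) =
      (p : ℂ) ^ (k - 1) * petPair k (translateV (p ^ (n + 1)) f) f := by
    intro j
    have h2 := petPair_slash (hV (n + 1)) hb (lowGL_det_pos p j)
    rw [translateV_pow_succ, translateV_slash_lowGL k _ j (translateV_nat_vadd hf _ j),
      petPair_smul_left (hV n) (hb.slash (lowGL_det_pos p j)), ← translateV_pow_succ, lowGL_det,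
      Rat.cast_natCast] at h2
    have h3 : (p : ℂ) ^ (k - 1) = p * (p : ℂ) ^ (k - 2) := by
      rw [← zpow_one_add₀ hp]; congr 1; ring
    rw [h3, mul_assoc, ← h2, mul_inv_cancel_left₀ hp]
  have h4 : petPair k (translateV (p ^ n) f) (∑ j ∈ Finset.range p, f ∣[k] realGL (lowGL p j)) =
      (p : ℂ) ^ k * petPair k (translateV (p ^ (n + 1)) f) f := by
    rw [petPair_sum_right _ (hV n) fun j => hb.slash (lowGL_det_pos p j)]
    simp_rw [h1]
    have h5 : (p : ℂ) ^ k = p * (p : ℂ) ^ (k - 1) := by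
      rw [← zpow_one_add₀ hp]; congr 1; ring
    rw [Finset.sum_const, Finset.card_range, nsmul_eq_mul, h5, mul_assoc]
  have h6 : petPair k (translateV (p ^ n) f) (lam • f) = _ :=
    petPair_smul_right (hV n) hb lam
  rw [← hlam, slash_diagGL, petPair_add_right (hV n)
    (IsBoundedSlash.sum _ fun j => hb.slash (lowGL_det_pos p j))
    (((hb.translateV p).smul _).smul _), h4, petPair_smul_right (hV n) ((hb.translateV p).smul _),
    petPair_smul_right (hV n) (hb.translateV p), conj_natCast_zpow] at h6
  rw [← h6, mul_assoc, add_sub_cancel_right, inv_mul_cancel_left₀ (zpow_ne_zero k hp)]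

/-- The Petersson product of `f` and `f | V_p` is real up to the value of the character. -/
theorem conj_petPair_translateV [NeZero N] (hf : f ∈ cuspFormSpace N χ k) (h : p.Coprime N) :
    conj (petPair k (translateV p f) f) = χ (p : ZMod N) * petPair k (translateV p f) f := by
  have hp : (p : ℂ) ≠ 0 := by exact_mod_cast NeZero.ne p
  have hb := isBoundedSlash_of_mem hf
  obtain ⟨γ, hγ, γ', hγ', h1, h2, h3⟩ := exists_highGL_mul_eq h
  rw [highGL_eq] at h3
  have hSL : ∀ δ : SL(2, ℤ), 0 < (Matrix.SpecialLinearGroup.mapGL ℚ δ).det.val := fun δ => by simp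
  have hχ : conj (χ (p : ZMod N)) * χ (p : ZMod N) = 1 := by
    have := norm_apply_of_mem_Gamma0 χ hγ'
    rw [h2, Int.cast_natCast] at this
    rw [Complex.conj_mul', this]; simp
  -- The matrices (1, 0; 0, p) and (p, 0; 0, 1) differ by elements of Γ₀(N) on either side; the left
  -- one has character value 1.
  have hA : f ∣[k] realGL (lowGL p 0) =
      (f ∣[k] realGL (diagGL p)) ∣[k] realGL (Matrix.SpecialLinearGroup.mapGL ℚ γ') := by
    have h4 := congrArg (fun g => f ∣[k] realGL g) h3
    simp only [realGL, map_mul, SlashAction.slash_mul] at h4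
    rw [realGL, realGL, h4]
    have h5 := slash_mapGL_of_mem hf hγ
    rw [h1] at h5
    rw [realGL] at h5
    rw [h5]
    simp
  -- Slashing by γ' preserves the product and multiplies the second argument f by χ(p), of modulus
  -- one.
  have hB : petPair k (f ∣[k] realGL (lowGL p 0)) f =
      χ (p : ZMod N) * petPair k (f ∣[k] realGL (diagGL p)) f := by
    have h4 := petPair_slash (hb.slash (diagGL_det_pos p)) hb (hSL γ')
    rw [← hA, slash_mapGL_of_mem hf hγ', h2, Int.cast_natCast,
      petPair_smul_right (hb.slash (lowGL_det_pos p 0)) hb] at h4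
    have h5 : ((((Matrix.SpecialLinearGroup.mapGL ℚ γ').det.val : ℚ) : ℂ)) = 1 := by simp
    rw [h5, one_zpow, one_mul] at h4
    rw [← h4, ← mul_assoc, mul_comm (χ _), hχ, one_mul]
  -- The product of the two diagonal matrices is the scalar p, so slashing by one is adjoint to
  -- slashing by the other.
  have hC : petPair k (f ∣[k] realGL (lowGL p 0)) f = petPair k f (f ∣[k] realGL (diagGL p)) := by
    have h4 := petPair_slash (hb.slash (lowGL_det_pos p 0)) hb (diagGL_det_pos p)
    have h5 : (f ∣[k] realGL (lowGL p 0)) ∣[k] realGL (diagGL p) = (p : ℂ) ^ (k - 2) • f := by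
      have hpp : (0 : ℚ) < (p : ℚ) * p := by
        have : (0 : ℚ) < p := by exact_mod_cast Nat.pos_of_ne_zero (NeZero.ne p)
        positivity
      have h6 : lowGL p 0 * diagGL p = triGL p 0 p hpp.ne' := by
        ext i j
        fin_cases i <;> fin_cases j <;> simp [Matrix.mul_apply, Fin.sum_univ_two, triGL_val]
      rw [← SlashAction.slash_mul, ← map_mul, h6]
      ext τ
      rw [slash_triGL k f hpp]
      have h7 : ofComplex (((p : ℚ) * (τ : ℂ) + ((0 : ℚ) : ℂ)) / ((p : ℚ) : ℂ)) = τ := by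
        have : (((p : ℚ) * (τ : ℂ) + ((0 : ℚ) : ℂ)) / ((p : ℚ) : ℂ)) = τ := by
          push_cast; field_simp; ring
        rw [this, ofComplex_apply]
      rw [h7, Rat.cast_natCast, Pi.smul_apply, smul_eq_mul, mul_zpow, ← zpow_add₀ hp,
        ← zpow_add₀ hp]
      congr 2
      ring
    rw [h5, petPair_smul_left hb (hb.slash (diagGL_det_pos p)), diagGL_det, Rat.cast_natCast] at h4
    exact (mul_left_cancel₀ (zpow_ne_zero _ hp) h4).symm
  rw [hB, slash_diagGL, petPair_smul_right hb (hb.translateV p),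
    petPair_smul_left (hb.translateV p) hb, conj_natCast_zpow, mul_left_comm] at hC
  rw [petPair_conj, ← mul_left_cancel₀ (zpow_ne_zero _ hp) hC]

end Relations

/-! ### Triangular changes of a family of vectors -/

section Triangularity

variable {E : Type*} [AddCommGroup E] [Module ℂ E] {V g : ℕ → E}

/-- A family obtained from another one by a triangular change spans the same spaces. -/
theorem span_image_Iio_eq_of_triangular
    (h : ∀ j, ∃ a : ℂ, a ≠ 0 ∧ g j - a • V j ∈ Submodule.span ℂ (V '' Set.Iio j)) (n : ℕ) :
    Submodule.span ℂ (g '' Set.Iio n) = Submodule.span ℂ (V '' Set.Iio n) := by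
  induction n with
  | zero => simp
  | succ n ih =>
    have hI : Set.Iio (n + 1) = insert n (Set.Iio n) := by
      ext m; simp [le_iff_eq_or_lt]
    obtain ⟨a, ha, hw⟩ := h n
    rw [hI, Set.image_insert_eq, Set.image_insert_eq, Submodule.span_insert, Submodule.span_insert,
      ih]
    set S := Submodule.span ℂ (V '' Set.Iio n)
    refine le_antisymm (sup_le ?_ le_sup_right) (sup_le ?_ le_sup_right)
    · rw [Submodule.span_singleton_le_iff_mem]
      have h1 : g n = a • V n + (g n - a • V n) := by abel
      rw [h1]
      exact Submodule.add_mem_sup (Submodule.smul_mem _ _ (Submodule.mem_span_singleton_self _)) hw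
    · rw [Submodule.span_singleton_le_iff_mem]
      have h1 : V n = a⁻¹ • g n + (-a⁻¹) • (g n - a • V n) := by
        rw [smul_sub, smul_smul, neg_mul, inv_mul_cancel₀ ha]
        module
      rw [h1]
      exact Submodule.add_mem_sup (Submodule.smul_mem _ _ (Submodule.mem_span_singleton_self _))
        (Submodule.smul_mem _ _ hw)

omit [AddCommGroup E] [Module ℂ E] in
theorem range_fin_eq_image_Iio (V : ℕ → E) (n : ℕ) :
    (Set.range fun j : Fin n => V j) = V '' Set.Iio n := by
  ext x
  constructor
  · rintro ⟨j, rfl⟩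
    exact ⟨j, j.2, rfl⟩
  · rintro ⟨j, hj, rfl⟩
    exact ⟨⟨j, hj⟩, rfl⟩

/-- The first n vectors of g span the same space as the first n of V, which has dimension n. -/
theorem linearIndependent_of_triangular (hV : LinearIndependent ℂ V)
    (h : ∀ j, ∃ a : ℂ, a ≠ 0 ∧ g j - a • V j ∈ Submodule.span ℂ (V '' Set.Iio j)) (n : ℕ) :
    LinearIndependent ℂ fun j : Fin n => g j := by
  have hV' : LinearIndependent ℂ fun j : Fin n => V j :=
    hV.comp (fun j : Fin n => (j : ℕ)) Fin.val_injective
  rw [linearIndependent_iff_card_eq_finrank_span, Set.finrank, range_fin_eq_image_Iio,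
    span_image_Iio_eq_of_triangular h, ← range_fin_eq_image_Iio]
  exact linearIndependent_iff_card_eq_finrank_span.1 hV'

end Triangularity

/-! ### Orthogonality and norms of the g_j -/

section Gram

open PrimitiveTranslates
open scoped ComplexConjugate

variable {k : ℤ}

theorem petPair_eq_zero_of_mem_span {u : ℍ → ℂ} (hu : IsBoundedSlash k u) {S : Set (ℍ → ℂ)}
    (hS : ∀ v ∈ S, IsBoundedSlash k v ∧ petPair k u v = 0) {w : ℍ → ℂ}
    (hw : w ∈ Submodule.span ℂ S) : IsBoundedSlash k w ∧ petPair k u w = 0 := by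
  induction hw using Submodule.span_induction with
  | mem v hv => exact hS v hv
  | zero =>
    refine ⟨IsBoundedSlash.zero k, ?_⟩
    simpa using petPair_smul_right hu hu 0
  | add v w _ _ hv hw =>
    refine ⟨hv.1.add hw.1, ?_⟩
    rw [petPair_add_right hu hv.1 hw.1, hv.2, hw.2, add_zero]
  | smul a v _ hv =>
    refine ⟨hv.1.smul a, ?_⟩
    rw [petPair_smul_right hu hv.1, hv.2, mul_zero]

variable {f : ℍ → ℂ} {p : ℕ} [NeZero p]

/-- A common V_p can be removed from both arguments for a factor p^(-k). Only the difference of the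
exponents then matters, and every entry of the Gram matrix reduces to some c_a or its conjugate. -/
theorem petPair_translateV_add (hf : IsBoundedSlash k f) (a b : ℕ) :
    petPair k (translateV (p ^ (a + b)) f) (translateV (p ^ b) f) =
      (((p : ℂ) ^ k) ^ b)⁻¹ * petPair k (translateV (p ^ a) f) f := by
  induction b with
  | zero => simp [translateV_one]
  | succ b ih =>
    rw [← add_assoc, translateV_pow_succ, translateV_pow_succ,
      petPair_translateV (hf.translateV _) (hf.translateV _), ih, pow_succ', mul_inv, mul_assoc]

theorem petPair_translateV_add' (hf : IsBoundedSlash k f) (a b : ℕ) :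
    petPair k (translateV (p ^ b) f) (translateV (p ^ (a + b)) f) =
      (((p : ℂ) ^ k) ^ b)⁻¹ * conj (petPair k (translateV (p ^ a) f) f) := by
  rw [← petPair_conj, petPair_translateV_add hf, map_mul, map_inv₀, map_pow, conj_natCast_zpow]

theorem halfPow_sq (p : ℕ) [NeZero p] (k : ℤ) (j : ℕ) :
    halfPow p k j * halfPow p k j = ((p : ℂ) ^ k) ^ j := by
  have hp : (0 : ℝ) < p := by exact_mod_cast Nat.pos_of_ne_zero (NeZero.ne p)
  rw [halfPow, ← Complex.ofReal_mul, ← Real.rpow_add hp]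
  have h : (j : ℝ) * k / 2 + j * k / 2 = ((k * j : ℤ) : ℝ) := by push_cast; ring
  rw [h, Real.rpow_intCast, zpow_mul, zpow_natCast]
  push_cast
  rfl

theorem halfPow_ne_zero (p : ℕ) [NeZero p] (k : ℤ) (j : ℕ) : halfPow p k j ≠ 0 := by
  have hp : (p : ℂ) ≠ 0 := by exact_mod_cast NeZero.ne p
  intro h
  have := halfPow_sq p k j
  rw [h, mul_zero] at this
  exact pow_ne_zero j (zpow_ne_zero k hp) this.symm

theorem conj_halfPow (p : ℕ) (k : ℤ) (j : ℕ) : conj (halfPow p k j) = halfPow p k j :=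
  Complex.conj_ofReal _

omit [NeZero p] in
theorem translateV_mem_span {i j : ℕ} (h : j < i) (f : ℍ → ℂ) : translateV (p ^ j) f ∈
    Submodule.span ℂ ((fun j => translateV (p ^ j) f) '' Set.Iio i) :=
  Submodule.subset_span ⟨j, h, rfl⟩

theorem basisDvd_triangular (p : ℕ) [NeZero p] (k : ℤ) (lam : ℂ) (f : ℍ → ℂ) (j : ℕ) :
    ∃ a : ℂ, a ≠ 0 ∧ basisDvd p k lam f j - a • translateV (p ^ j) f ∈
      Submodule.span ℂ ((fun j => translateV (p ^ j) f) '' Set.Iio j) := by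
  cases j with
  | zero => exact ⟨1, one_ne_zero, by simp [basisDvd, translateV_one]⟩
  | succ j =>
    refine ⟨halfPow p k (j + 1), halfPow_ne_zero p k _, ?_⟩
    rw [basisDvd, smul_sub, sub_sub_cancel_left, smul_smul]
    exact neg_mem (Submodule.smul_mem _ _ (translateV_mem_span (Nat.lt_succ_self j) f))

theorem basisNotDvd_triangular (p : ℕ) [NeZero p] (k : ℤ) (lam c : ℂ) (f : ℍ → ℂ) (j : ℕ) :
    ∃ a : ℂ, a ≠ 0 ∧ basisNotDvd p k lam c f j - a • translateV (p ^ j) f ∈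
      Submodule.span ℂ ((fun j => translateV (p ^ j) f) '' Set.Iio j) := by
  match j with
  | 0 => exact ⟨1, one_ne_zero, by simp [basisNotDvd, translateV_one]⟩
  | 1 =>
    refine ⟨halfPow p k 1, halfPow_ne_zero p k _, ?_⟩
    rw [basisNotDvd, pow_one, sub_sub_cancel_left]
    refine neg_mem (Submodule.smul_mem _ _ ?_)
    have h := translateV_mem_span (p := p) Nat.zero_lt_one f
    rwa [pow_zero, translateV_one] at h
  | j + 2 =>
    refine ⟨halfPow p k (j + 2), halfPow_ne_zero p k _, ?_⟩
    rw [basisNotDvd, ← smul_sub, add_sub_right_comm, sub_sub_cancel_left]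
    refine Submodule.smul_mem _ _ (add_mem (neg_mem ?_) ?_) <;> refine Submodule.smul_mem _ _ ?_
    · exact translateV_mem_span (by omega) f
    · exact translateV_mem_span (by omega) f

variable {lam x : ℂ}

theorem IsBoundedSlash.sub {u v : ℍ → ℂ} (hu : IsBoundedSlash k u) (hv : IsBoundedSlash k v) :
    IsBoundedSlash k (u - v) := by
  have h : u - v = u + (-1 : ℂ) • v := by simp [sub_eq_add_neg]
  rw [h]
  exact hu.add (hv.smul _)

/-- After removing p^j from both arguments, the claim is the recursion c_{m+1} = λ̄ p^(-k) c_m. -/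
theorem petPair_basisDvd_translateV (hf : IsBoundedSlash k f)
    (hrec : ∀ n, petPair k (translateV (p ^ (n + 1)) f) f =
      ((p : ℂ) ^ k)⁻¹ * (conj lam * petPair k (translateV (p ^ n) f) f)) {i j : ℕ} (h : j < i) :
    petPair k (basisDvd p k lam f i) (translateV (p ^ j) f) = 0 := by
  have hV : ∀ n, IsBoundedSlash k (translateV (p ^ n) f) := fun n => hf.translateV _
  obtain ⟨m, rfl⟩ := Nat.exists_eq_add_of_lt h
  have h1 := petPair_translateV_add (p := p) hf (m + 1) j
  have h2 := petPair_translateV_add (p := p) hf m j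
  rw [show m + 1 + j = j + m + 1 by ring, hrec] at h1
  rw [show m + j = j + m by ring] at h2
  rw [basisDvd, petPair_smul_left ((hV _).sub ((hV _).smul _)) (hV _),
    petPair_sub_left (hV _) ((hV _).smul _) (hV _), petPair_smul_left (hV _) (hV _), h1, h2]
  ring

theorem petPair_basisDvd_self (hf : IsBoundedSlash k f) (h1 : petPair k f f = 1)
    (hrec : ∀ n, petPair k (translateV (p ^ (n + 1)) f) f =
      ((p : ℂ) ^ k)⁻¹ * (conj lam * petPair k (translateV (p ^ n) f) f)) (j : ℕ) :
    petPair k (basisDvd p k lam f (j + 1)) (basisDvd p k lam f (j + 1)) =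
      1 - (‖lam‖ : ℂ) ^ 2 / (p : ℂ) ^ k := by
  have hP : (p : ℂ) ^ k ≠ 0 := zpow_ne_zero k (by exact_mod_cast NeZero.ne p)
  have hV : ∀ n, IsBoundedSlash k (translateV (p ^ n) f) := fun n => hf.translateV _
  have hW : IsBoundedSlash k (translateV (p ^ (j + 1)) f -
    (conj lam / (p : ℂ) ^ k) • translateV (p ^ j) f) := (hV _).sub ((hV _).smul _)
  have hg : IsBoundedSlash k (basisDvd p k lam f (j + 1)) := hW.smul _
  have h0 := petPair_basisDvd_translateV hf hrec (Nat.lt_succ_self j)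
  have e1 := petPair_translateV_add (p := p) hf 0 (j + 1)
  have e2 := petPair_translateV_add' (p := p) hf 1 j
  have e3 := hrec 0
  simp only [zero_add, pow_zero, translateV_one, h1, mul_one] at e1 e3
  rw [add_comm 1 j, e3, map_mul, map_inv₀, conj_natCast_zpow, Complex.conj_conj] at e2
  -- Only the second factor is expanded: its lower translate is orthogonal to the first factor, so
  -- just the leading term survives.
  conv_lhs => arg 3; rw [basisDvd]
  rw [petPair_smul_right hg hW, petPair_sub_right hg (hV _) ((hV _).smul _),
    petPair_smul_right hg (hV _), h0, mul_zero, sub_zero, basisDvd, petPair_smul_left hW (hV _),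
    petPair_sub_left (hV _) ((hV _).smul _) (hV _), petPair_smul_left (hV _) (hV _), e1, e2,
    conj_halfPow, ← mul_assoc, halfPow_sq, ← Complex.conj_mul']
  field_simp
  ring

/-- The Petersson product of `f | V_p` and `f`, by the Hecke relation at a prime not dividing
the level. -/
theorem petPair_translateV_one_eq (h1 : petPair k f f = 1)
    (hx : conj x * x = 1)
    (hconj : conj (petPair k (translateV p f) f) = x * petPair k (translateV p f) f)
    (hrec : ∀ n, petPair k (translateV (p ^ (n + 1)) f) f = ((p : ℂ) ^ k)⁻¹ *
      (conj lam * petPair k (translateV (p ^ n) f) f - conj x * (p : ℂ) ^ (k - 1) *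
        petPair k (translateV (p ^ n) f) (translateV p f))) :
    petPair k (translateV p f) f = conj lam / ((p : ℂ) ^ k * (1 + 1 / (p : ℂ))) := by
  have hp : (p : ℂ) ≠ 0 := by exact_mod_cast NeZero.ne p
  have hP : (p : ℂ) ^ k ≠ 0 := zpow_ne_zero k hp
  have hp1 : (p : ℂ) + 1 ≠ 0 := by exact_mod_cast Nat.succ_ne_zero p
  have h := hrec 0
  rw [zero_add, pow_one, pow_zero, translateV_one, h1,
    ← petPair_conj k (translateV p f) f, hconj, zpow_sub_one₀ hp] at h
  have h2 : conj x * ((p : ℂ) ^ k * (p : ℂ)⁻¹) * (x * petPair k (translateV p f) f) =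
      (p : ℂ) ^ k * (p : ℂ)⁻¹ * petPair k (translateV p f) f := by
    linear_combination ((p : ℂ) ^ k * (p : ℂ)⁻¹ * petPair k (translateV p f) f) * hx
  rw [h2] at h
  field_simp at h ⊢
  linear_combination h

/-- At n + 1 the last term of the Hecke relation has V_p in both arguments, so it equals p^(-k) c_n
up to its coefficient. -/
theorem petPair_translateV_add_two (hf : IsBoundedSlash k f)
    (hrec : ∀ n, petPair k (translateV (p ^ (n + 1)) f) f = ((p : ℂ) ^ k)⁻¹ *
      (conj lam * petPair k (translateV (p ^ n) f) f - conj x * (p : ℂ) ^ (k - 1) *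
        petPair k (translateV (p ^ n) f) (translateV p f))) (n : ℕ) :
    petPair k (translateV (p ^ (n + 2)) f) f =
      conj lam / (p : ℂ) ^ k * petPair k (translateV (p ^ (n + 1)) f) f -
        conj x / (p : ℂ) ^ (k + 1) * petPair k (translateV (p ^ n) f) f := by
  have hp : (p : ℂ) ≠ 0 := by exact_mod_cast NeZero.ne p
  have hP : (p : ℂ) ^ k ≠ 0 := zpow_ne_zero k hp
  have h := hrec (n + 1)
  have h2 := petPair_translateV_add (p := p) hf n 1
  rw [pow_one, pow_one] at h2
  rw [h2, zpow_sub_one₀ hp] at h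
  rw [h, zpow_add_one₀ hp]
  field_simp

/-- The coefficient of f in g_1 is p^(k/2) c_1, the Gram-Schmidt projection; g_1 does not follow the
recursion of order two. -/
theorem petPair_basisNotDvd_one_translateV (hf : IsBoundedSlash k f) (h1 : petPair k f f = 1)
    (hc : petPair k (translateV p f) f = conj lam / ((p : ℂ) ^ k * (1 + 1 / (p : ℂ)))) :
    petPair k (basisNotDvd p k lam x f 1) f = 0 := by
  have hp : (p : ℂ) ≠ 0 := by exact_mod_cast NeZero.ne p
  have hP : (p : ℂ) ^ k ≠ 0 := zpow_ne_zero k hp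
  have hp1 : (p : ℂ) + 1 ≠ 0 := by exact_mod_cast Nat.succ_ne_zero p
  have hh := halfPow_ne_zero p k 1
  have hh2 := halfPow_sq p k 1
  rw [pow_one] at hh2
  rw [basisNotDvd, petPair_sub_left ((hf.translateV _).smul _) (hf.smul _) hf,
    petPair_smul_left (hf.translateV _) hf, petPair_smul_left hf hf, h1, hc, ← hh2]
  field_simp
  ring

theorem petPair_basisNotDvd_one_self (hf : IsBoundedSlash k f) (h1 : petPair k f f = 1)
    (hc : petPair k (translateV p f) f = conj lam / ((p : ℂ) ^ k * (1 + 1 / (p : ℂ)))) :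
    petPair k (basisNotDvd p k lam x f 1) (basisNotDvd p k lam x f 1) =
      1 - (‖lam‖ : ℂ) ^ 2 / ((p : ℂ) ^ k * (1 + 1 / (p : ℂ)) ^ 2) := by
  have hp : (p : ℂ) ≠ 0 := by exact_mod_cast NeZero.ne p
  have hP : (p : ℂ) ^ k ≠ 0 := zpow_ne_zero k hp
  have hp1 : (p : ℂ) + 1 ≠ 0 := by exact_mod_cast Nat.succ_ne_zero p
  have hh := halfPow_ne_zero p k 1
  have hh2 := halfPow_sq p k 1
  rw [pow_one] at hh2
  have hV := hf.translateV p
  have hg : IsBoundedSlash k (basisNotDvd p k lam x f 1) := (hV.smul _).sub (hf.smul _)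
  have h0 := petPair_basisNotDvd_one_translateV (x := x) hf h1 hc
  have hc' : petPair k f (translateV p f) = lam / ((p : ℂ) ^ k * (1 + 1 / (p : ℂ))) := by
    rw [← petPair_conj, hc]
    simp
  have h2 : petPair k (translateV p f) (translateV p f) = ((p : ℂ) ^ k)⁻¹ := by
    rw [petPair_translateV hf hf, h1, mul_one]
  conv_lhs => arg 3; rw [basisNotDvd]
  rw [petPair_sub_right hg (hV.smul _) (hf.smul _), petPair_smul_right hg hf, h0, mul_zero,
    sub_zero, petPair_smul_right hg hV, basisNotDvd, petPair_sub_left (hV.smul _) (hf.smul _) hV,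
    petPair_smul_left hV hV, petPair_smul_left hf hV, h2, hc', conj_halfPow, ← Complex.conj_mul',
    ← hh2]
  field_simp

theorem petPair_basisNotDvd_add_two (hf : IsBoundedSlash k f) {w : ℍ → ℂ}
    (hw : IsBoundedSlash k w) (m : ℕ) :
    petPair k (basisNotDvd p k lam x f (m + 2)) w = halfPow p k (m + 2) *
      (petPair k (translateV (p ^ (m + 2)) f) w -
        conj lam / (p : ℂ) ^ k * petPair k (translateV (p ^ (m + 1)) f) w +
        conj x / (p : ℂ) ^ (k + 1) * petPair k (translateV (p ^ m) f) w) := by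
  have hV : ∀ n, IsBoundedSlash k (translateV (p ^ n) f) := fun n => hf.translateV _
  rw [basisNotDvd, petPair_smul_left (((hV _).sub ((hV _).smul _)).add ((hV _).smul _)) hw,
    petPair_add_left ((hV _).sub ((hV _).smul _)) ((hV _).smul _) hw,
    petPair_sub_left (hV _) ((hV _).smul _) hw, petPair_smul_left (hV _) hw,
    petPair_smul_left (hV _) hw]

theorem petPair_basisNotDvd_translateV (hf : IsBoundedSlash k f) (h1 : petPair k f f = 1)
    (hx : conj x * x = 1)
    (hconj : conj (petPair k (translateV p f) f) = x * petPair k (translateV p f) f)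
    (hrec : ∀ n, petPair k (translateV (p ^ (n + 1)) f) f = ((p : ℂ) ^ k)⁻¹ *
      (conj lam * petPair k (translateV (p ^ n) f) f - conj x * (p : ℂ) ^ (k - 1) *
        petPair k (translateV (p ^ n) f) (translateV p f))) {i j : ℕ} (h : j < i) :
    petPair k (basisNotDvd p k lam x f i) (translateV (p ^ j) f) = 0 := by
  have hp : (p : ℂ) ≠ 0 := by exact_mod_cast NeZero.ne p
  have hP : (p : ℂ) ^ k ≠ 0 := zpow_ne_zero k hp
  have hp1 : (p : ℂ) + 1 ≠ 0 := by exact_mod_cast Nat.succ_ne_zero p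
  have hc := petPair_translateV_one_eq h1 hx hconj hrec
  match i with
  | 0 => omega
  | 1 =>
    obtain rfl : j = 0 := by omega
    rw [pow_zero, translateV_one]
    exact petPair_basisNotDvd_one_translateV hf h1 hc
  | m + 2 =>
    rw [petPair_basisNotDvd_add_two hf (hf.translateV _)]
    -- For j = m + 1 the last translate has the smaller exponent, so conj c_1 = χ(p) c_1 enters and
    -- the claim is c_1 (1 + 1/p) = λ̄ p^(-k). For j ≤ m it is the recursion of order two,
    -- multiplied by p^(-kj).
    rcases Nat.lt_or_ge m j with hj | hj
    · obtain rfl : j = m + 1 := by omega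
      have e1 := petPair_translateV_add (p := p) hf 1 (m + 1)
      have e2 := petPair_translateV_add (p := p) hf 0 (m + 1)
      have e3 := petPair_translateV_add' (p := p) hf 1 m
      rw [show 1 + (m + 1) = m + 2 by ring, pow_one] at e1
      rw [zero_add, pow_zero, translateV_one, h1, mul_one] at e2
      rw [add_comm 1 m, pow_one, hconj] at e3
      have h2 : conj x / (p : ℂ) ^ (k + 1) *
          ((((p : ℂ) ^ k) ^ m)⁻¹ * (x * petPair k (translateV p f) f)) =
          ((p : ℂ) ^ (k + 1))⁻¹ * (((p : ℂ) ^ k) ^ m)⁻¹ * petPair k (translateV p f) f := by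
        linear_combination ((p : ℂ) ^ (k + 1))⁻¹ * (((p : ℂ) ^ k) ^ m)⁻¹ *
          petPair k (translateV p f) f * hx
      rw [e1, e2, e3, h2, hc, zpow_add_one₀ hp, pow_succ]
      field_simp
      ring
    · obtain ⟨d, rfl⟩ := Nat.exists_eq_add_of_le' hj
      have e1 := petPair_translateV_add (p := p) hf (d + 2) j
      have e2 := petPair_translateV_add (p := p) hf (d + 1) j
      rw [petPair_translateV_add_two hf hrec, add_right_comm] at e1
      rw [add_right_comm] at e2
      rw [e1, e2, petPair_translateV_add hf d j]
      ring

theorem petPair_basisNotDvd_self (hf : IsBoundedSlash k f) (h1 : petPair k f f = 1)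
    (hx : conj x * x = 1)
    (hconj : conj (petPair k (translateV p f) f) = x * petPair k (translateV p f) f)
    (hrec : ∀ n, petPair k (translateV (p ^ (n + 1)) f) f = ((p : ℂ) ^ k)⁻¹ *
      (conj lam * petPair k (translateV (p ^ n) f) f - conj x * (p : ℂ) ^ (k - 1) *
        petPair k (translateV (p ^ n) f) (translateV p f))) (m : ℕ) :
    petPair k (basisNotDvd p k lam x f (m + 2)) (basisNotDvd p k lam x f (m + 2)) =
      (1 - 1 / (p : ℂ) ^ 2) * (1 - (‖lam‖ : ℂ) ^ 2 / ((p : ℂ) ^ k * (1 + 1 / (p : ℂ)) ^ 2)) := by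
  have hp : (p : ℂ) ≠ 0 := by exact_mod_cast NeZero.ne p
  have hP : (p : ℂ) ^ k ≠ 0 := zpow_ne_zero k hp
  have hp1 : (p : ℂ) + 1 ≠ 0 := by exact_mod_cast Nat.succ_ne_zero p
  have hV : ∀ n, IsBoundedSlash k (translateV (p ^ n) f) := fun n => hf.translateV _
  have hc := petPair_translateV_one_eq h1 hx hconj hrec
  -- Comparing the explicit value of c_1 with conj c_1 = χ(p) c_1 gives λ = χ(p) λ̄, which turns
  -- χ̄(p) λ² into |λ|² in the norm.
  have hlam : lam = x * conj lam := by
    rw [hc] at hconj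
    simp only [map_div₀, map_mul, conj_natCast_zpow, map_add, map_one, Complex.conj_natCast,
      Complex.conj_conj] at hconj
    field_simp at hconj
    exact hconj
  have hW : IsBoundedSlash k (translateV (p ^ (m + 2)) f -
      (conj lam / (p : ℂ) ^ k) • translateV (p ^ (m + 1)) f +
      (conj x / (p : ℂ) ^ (k + 1)) • translateV (p ^ m) f) :=
    ((hV _).sub ((hV _).smul _)).add ((hV _).smul _)
  have hg : IsBoundedSlash k (basisNotDvd p k lam x f (m + 2)) := hW.smul _
  have hpair : petPair k (basisNotDvd p k lam x f (m + 2)) (basisNotDvd p k lam x f (m + 2)) =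
      halfPow p k (m + 2) *
        petPair k (basisNotDvd p k lam x f (m + 2)) (translateV (p ^ (m + 2)) f) := by
    conv_lhs => arg 3; rw [basisNotDvd]
    rw [petPair_smul_right hg hW, petPair_add_right hg ((hV _).sub ((hV _).smul _)) ((hV _).smul _),
      petPair_sub_right hg (hV _) ((hV _).smul _), petPair_smul_right hg (hV _),
      petPair_smul_right hg (hV _),
      petPair_basisNotDvd_translateV hf h1 hx hconj hrec (by omega : m + 1 < m + 2),
      petPair_basisNotDvd_translateV hf h1 hx hconj hrec (by omega : m < m + 2), conj_halfPow]
    ring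
  have e1 := petPair_translateV_add (p := p) hf 0 (m + 2)
  have e2 := petPair_translateV_add' (p := p) hf 1 (m + 1)
  have e3 := petPair_translateV_add' (p := p) hf 2 m
  rw [zero_add, pow_zero, translateV_one, h1, mul_one] at e1
  rw [show 1 + (m + 1) = m + 2 by ring, pow_one, hc] at e2
  rw [show 2 + m = m + 2 by ring, show 2 = 0 + 2 from rfl, petPair_translateV_add_two hf hrec,
    zero_add, pow_one, pow_zero, translateV_one, h1, hc] at e3
  simp only [map_sub, map_div₀, map_mul, conj_natCast_zpow, map_add, map_one, Complex.conj_natCast,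
      Complex.conj_conj] at e2 e3
  rw [hpair, petPair_basisNotDvd_add_two hf (hV _), ← mul_assoc, halfPow_sq, e1, e2, e3,
    ← Complex.conj_mul', zpow_add_one₀ hp, pow_add, pow_succ]
  have hlam' : conj x * lam = conj lam := by
    linear_combination conj x * hlam + conj lam * hx
  have e4 : conj x * (lam * lam) = conj lam * lam := by rw [← mul_assoc, hlam']
  field_simp
  linear_combination (p ^ 2 + p ^ 3) * (p : ℂ) ^ k * ((p : ℂ) ^ k) ^ m * e4 -
    (p + 1) ^ 2 * ((p : ℂ) ^ k) ^ 2 * ((p : ℂ) ^ k) ^ m * hx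

end Gram

/-! ### Normalised forms and orthogonal bases -/

section Normalization

open PrimitiveTranslates
open scoped ComplexConjugate

variable {N : ℕ} [NeZero N] {χ : DirichletCharacter ℂ N} {k : ℤ} {f : ℍ → ℂ} {p : ℕ}

theorem exists_normalizedForm_eq_smul (hf : f ∈ cuspFormSpace N χ k) (h0 : f ≠ 0) :
    ∃ s : ℂ, s ≠ 0 ∧ normalizedForm N k f = s • f ∧
      petPair k (normalizedForm N k f) (normalizedForm N k f) = 1 := by
  have hb := isBoundedSlash_of_mem hf
  obtain ⟨x, hx, hxe⟩ := exists_petPair_self k f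
  have hx0 : x ≠ 0 := by
    rintro rfl
    exact petPair_self_ne_zero hb h0 (by simpa using hxe)
  have hs : (Real.sqrt x : ℂ) ≠ 0 := by
    exact_mod_cast (Real.sqrt_pos.2 (lt_of_le_of_ne hx hx0.symm)).ne'
  have hF : normalizedForm N k f = (Real.sqrt x : ℂ)⁻¹ • f := by
    rw [normalizedForm, peterssonInner_eq_of_mem hf hf, hxe, Complex.ofReal_re]
  refine ⟨_, inv_ne_zero hs, hF, ?_⟩
  have hsq : (Real.sqrt x : ℂ) * Real.sqrt x = x := by exact_mod_cast Real.mul_self_sqrt hx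
  rw [hF, petPair_smul_left hb (hb.smul _), petPair_smul_right hb hb, hxe, map_inv₀,
    Complex.conj_ofReal, ← hsq]
  field_simp

theorem sum_slash_smul_eq [NeZero p] {lam a : ℂ} (s : ℂ)
    (h : ∑ j ∈ Finset.range p, f ∣[k] realGL (lowGL p j) + a • (f ∣[k] realGL (diagGL p)) =
      lam • f) :
    ∑ j ∈ Finset.range p, (s • f) ∣[k] realGL (lowGL p j) +
      a • ((s • f) ∣[k] realGL (diagGL p)) = lam • s • f := by
  have h1 : ∀ A : GL (Fin 2) ℚ, 0 < A.det.val → (s • f) ∣[k] realGL A = s • (f ∣[k] realGL A) := by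
    intro A hA
    rw [ModularForm.smul_slash, σ, if_pos (realGL_det_pos hA)]
    rfl
  simp only [h1 _ (lowGL_det_pos p _), h1 _ (diagGL_det_pos p)]
  rw [← Finset.smul_sum, smul_comm a s, ← smul_add, h, smul_comm]

theorem translateSpan_smul (p r : ℕ) {s : ℂ} (hs : s ≠ 0) (f : ℍ → ℂ) :
    translateSpan p r f =
      Submodule.span ℂ ((fun j => translateV (p ^ j) (s • f)) '' Set.Iio (r + 1)) := by
  rw [translateSpan, range_fin_eq_image_Iio (fun j => translateV (p ^ j) f)]
  exact (span_image_Iio_eq_of_triangular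
    (fun j => ⟨s, hs, by rw [translateV_smul, sub_self]; exact zero_mem _⟩) _).symm

omit [NeZero N] in
theorem translateSpan_le {r M : ℕ} [NeZero p] (hf : f ∈ cuspFormSpace N χ k) (hM : N * p ^ r ∣ M) :
    translateSpan p r f ≤ cuspFormSpace M
      (DirichletCharacter.changeLevel (Dvd.dvd.trans (Nat.dvd_mul_right N (p ^ r)) hM) χ) k := by
  rw [translateSpan, Submodule.span_le]
  rintro _ ⟨j, rfl⟩
  have h : N * p ^ (j : ℕ) ∣ M :=
    (Nat.mul_dvd_mul_left N (pow_dvd_pow p (Nat.lt_succ_iff.1 j.2))).trans hM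
  exact translateV_mem h hf

/-- A family that is triangular with respect to the translates of a form, and orthogonal to the
preceding translates, is an orthogonal basis of their span. -/
theorem isOrthogonalBasis_of_triangular {r M : ℕ} [NeZero M] [NeZero p] {ψ : DirichletCharacter ℂ M}
    {W : Submodule ℂ (ℍ → ℂ)} (hf : IsBoundedSlash k f)
    (hV : LinearIndependent ℂ fun j : ℕ => translateV (p ^ j) f)
    (hW : W = Submodule.span ℂ ((fun j => translateV (p ^ j) f) '' Set.Iio (r + 1)))
    (hWM : W ≤ cuspFormSpace M ψ k) {g : ℕ → ℍ → ℂ}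
    (hg : ∀ j, ∃ a : ℂ, a ≠ 0 ∧ g j - a • translateV (p ^ j) f ∈
      Submodule.span ℂ ((fun j => translateV (p ^ j) f) '' Set.Iio j))
    (h0 : ∀ i j, j < i → petPair k (g i) (translateV (p ^ j) f) = 0) :
    (∀ j, j ≤ r → peterssonInner M k (g j) (g j) = petPair k (g j) (g j)) ∧
      IsOrthogonalBasis M k W (fun j : Fin (r + 1) => g j) := by
  have hspan : ∀ n, Submodule.span ℂ (g '' Set.Iio n) =
      Submodule.span ℂ ((fun j => translateV (p ^ j) f) '' Set.Iio n) :=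
    span_image_Iio_eq_of_triangular hg
  have hmem : ∀ j, j ≤ r → g j ∈ cuspFormSpace M ψ k := fun j hj => by
    refine hWM ?_
    rw [hW, ← hspan]
    exact Submodule.subset_span ⟨j, Nat.lt_succ_iff.2 hj, rfl⟩
  have horth : ∀ i j, j < i → i ≤ r → petPair k (g i) (g j) = 0 := fun i j h hi => by
    refine (petPair_eq_zero_of_mem_span (isBoundedSlash_of_mem (hmem i hi))
      (S := (fun j => translateV (p ^ j) f) '' Set.Iio i) ?_ ?_).2
    · rintro _ ⟨m, hm, rfl⟩
      exact ⟨hf.translateV _, h0 i m hm⟩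
    · rw [← hspan]
      exact Submodule.subset_span ⟨j, h, rfl⟩
  refine ⟨fun j hj => peterssonInner_eq_of_mem (hmem j hj) (hmem j hj),
    linearIndependent_of_triangular hV hg _, ?_, fun i j hij => ?_⟩
  · rw [range_fin_eq_image_Iio, hspan, hW]
  · have hi := Nat.lt_succ_iff.1 i.2
    have hj := Nat.lt_succ_iff.1 j.2
    rw [peterssonInner_eq_of_mem (hmem i hi) (hmem j hj)]
    rcases lt_or_gt_of_ne (Fin.val_injective.ne hij) with h | h
    · rw [← petPair_conj, horth j i h hj, map_zero]
    · exact horth i j h hi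

end Normalization

/-! ### The main theorem -/

theorem mainTheorem2 (N : ℕ) [NeZero N] (χ : DirichletCharacter ℂ N) (k : ℤ) (f : ℍ → ℂ)
    (hf : PrimitiveTranslates.IsPrimitiveForm N χ k f)
    (p : ℕ) (hp : p.Prime) (r : ℕ)
    (M : ℕ) [NeZero M] (hM : N * p ^ r ∣ M)
    (lam : ℂ) (hlam : PrimitiveTranslates.heckeT N χ k 1 p f = lam • f) :
    -- `W_p(f)` lies in `S_k(Γ₀(M), χ)` and the Petersson integrals on it converge
    (PrimitiveTranslates.translateSpan p r f ≤
        PrimitiveTranslates.cuspFormSpace M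
          (DirichletCharacter.changeLevel (Dvd.dvd.trans (Nat.dvd_mul_right N (p ^ r)) hM) χ) k ∧
      ∀ u ∈ PrimitiveTranslates.translateSpan p r f,
        ∀ v ∈ PrimitiveTranslates.translateSpan p r f,
          IntegrableOn (petersson k v u) (PrimitiveTranslates.fundDomain M)) ∧
    -- the case `p ∣ N`
    (p ∣ N →
      ∀ g : ℕ → ℍ → ℂ,
        g = PrimitiveTranslates.basisDvd p k lam (PrimitiveTranslates.normalizedForm N k f) →
        PrimitiveTranslates.IsOrthogonalBasis M k (PrimitiveTranslates.translateSpan p r f)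
          (fun j : Fin (r + 1) => g j) ∧
        PrimitiveTranslates.peterssonInner M k (g 0) (g 0) = 1 ∧
        ∀ j : ℕ, 1 ≤ j → j ≤ r →
          PrimitiveTranslates.peterssonInner M k (g j) (g j)
            = 1 - (‖lam‖ : ℂ) ^ 2 / (p : ℂ) ^ k) ∧
    -- the case `p ∤ N`
    (¬ p ∣ N →
      ∀ g : ℕ → ℍ → ℂ,
        g = PrimitiveTranslates.basisNotDvd p k lam (χ (p : ZMod N))
          (PrimitiveTranslates.normalizedForm N k f) →
        PrimitiveTranslates.IsOrthogonalBasis M k (PrimitiveTranslates.translateSpan p r f)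
          (fun j : Fin (r + 1) => g j) ∧
        PrimitiveTranslates.peterssonInner M k (g 0) (g 0) = 1 ∧
        (1 ≤ r → PrimitiveTranslates.peterssonInner M k (g 1) (g 1)
            = 1 - (‖lam‖ : ℂ) ^ 2 / ((p : ℂ) ^ k * (1 + 1 / (p : ℂ)) ^ 2)) ∧
        ∀ j : ℕ, 2 ≤ j → j ≤ r →
          PrimitiveTranslates.peterssonInner M k (g j) (g j)
            = (1 - 1 / (p : ℂ) ^ 2)
              * (1 - (‖lam‖ : ℂ) ^ 2 / ((p : ℂ) ^ k * (1 + 1 / (p : ℂ)) ^ 2))) := by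
  have : NeZero p := ⟨hp.ne_zero⟩
  have hmem := hf.mem
  obtain ⟨s, hs, hF, hF1⟩ := exists_normalizedForm_eq_smul hmem
    (ne_zero_of_coeff_ne_zero (by rw [hf.normalized]; exact one_ne_zero))
  have hWM := translateSpan_le hmem hM
  have hW := translateSpan_smul p r hs f
  rw [← hF] at hW
  have hFmem : PrimitiveTranslates.normalizedForm N k f ∈
      PrimitiveTranslates.cuspFormSpace N χ k := by
    rw [hF]
    exact Submodule.smul_mem _ _ hmem
  have hFb := isBoundedSlash_of_mem hFmem
  have hV : LinearIndependent ℂ fun j : ℕ =>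
      PrimitiveTranslates.translateV (p ^ j) (PrimitiveTranslates.normalizedForm N k f) := by
    have h1 := linearIndependent_translateV hmem (by rw [hf.normalized]; exact one_ne_zero) hp
    have h2 := h1.units_smul fun _ => Units.mk0 s hs
    rw [hF]
    exact h2
  rw [heckeT_eq_sum hmem hp] at hlam
  have hlamF := sum_slash_smul_eq s hlam
  rw [← hF] at hlamF
  have hrec := petPair_translateV_succ hFmem hlamF
  refine ⟨⟨hWM, fun u hu v hv => integrableOn_petersson_of_mem (hWM hu) (hWM hv)⟩, ?_, ?_⟩
  · rintro hpN g rfl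
    -- With χ(p) = 0 the Hecke relation becomes the geometric recursion.
    have hχ : χ (p : ZMod N) = 0 := MulChar.map_nonunit χ fun h =>
      hp.coprime_iff_not_dvd.1 ((ZMod.isUnit_iff_coprime p N).1 h) hpN
    simp only [hχ, map_zero, zero_mul, sub_zero] at hrec
    obtain ⟨h1, h2⟩ := isOrthogonalBasis_of_triangular hFb hV hW hWM
      (basisDvd_triangular p k lam _) fun _ _ => petPair_basisDvd_translateV hFb hrec
    refine ⟨h2, (h1 0 (Nat.zero_le r)).trans hF1, fun j hj hjr => ?_⟩
    obtain ⟨m, rfl⟩ := Nat.exists_eq_add_of_le' hj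
    rw [h1 _ hjr, petPair_basisDvd_self hFb hF1 hrec]
  · rintro hpN g rfl
    have hcop := hp.coprime_iff_not_dvd.2 hpN
    have hconj := conj_petPair_translateV hFmem hcop
    have hχ : (starRingEnd ℂ) (χ (p : ZMod N)) * χ (p : ZMod N) = 1 := by
      rw [Complex.conj_mul', ← ZMod.coe_unitOfCoprime p hcop, χ.unit_norm_eq_one]
      simp
    have hc := petPair_translateV_one_eq hF1 hχ hconj hrec
    obtain ⟨h1, h2⟩ := isOrthogonalBasis_of_triangular hFb hV hW hWM
      (basisNotDvd_triangular p k lam (χ (p : ZMod N)) _) fun _ _ =>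
        petPair_basisNotDvd_translateV hFb hF1 hχ hconj hrec
    refine ⟨h2, (h1 0 (Nat.zero_le r)).trans hF1, fun hr => ?_, fun j hj hjr => ?_⟩
    · rw [h1 1 hr, petPair_basisNotDvd_one_self hFb hF1 hc]
    · obtain ⟨m, rfl⟩ := Nat.exists_eq_add_of_le' hj
      rw [h1 _ hjr, petPair_basisNotDvd_self hFb hF1 hχ hconj hrec]
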